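/- Let $n\in\mathbb N$, let $p$ be a real number with $1<p<n$, let $M>1$, and let $Q^n=(0,1)^n\subset\mathbb R^n$. Let $|\cdot|$ be the Euclidean norm on $\mathbb R^n$ and let $|A|$, for a linear map $A:\mathbb R^n\to\mathbb R^n$, be either the operator norm of $A$ or the Frobenius norm of $A$ (the square root of the sum of the squares of the matrix entries); the statement holds for each of the two choices. Let $X$ be the set of all homeomorphisms $f:Q^n\to Q^n$ of the open cube onto itself such that (i) $f_{|\partial Q^n}=\mathrm{Id}$, i.e. $f(y)\to x$ as $y\to x$, $y\in Q^n$, for every $x\in\partial Q^n$; (ii) $f\in W^{1,p}(Q^n;\mathbb R^n)$, with weak derivative $Df$; (iii) $\int_{Q^n}|Df|^p\,dx\le M$. Equip $X$ with the metric $$d(f,g):=\|f-g\|_\infty+\|f^{-1}-g^{-1}\|_\infty,\qquad \|h\|_\infty:=\sup_{x\in Q^n}|h(x)|.$$ Then the set $A$ of all $f\in X$ whose Jacobian $Jf=\det Df$ vanishes almost everywhere in $Q^n$ is of first category in $X$; that is, $X\setminus A$ is residual in $X$ (it contains a countable intersection of dense open subsets of $X$). -/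

import Mathlib

open MeasureTheory Set Filter Topology
open scoped ContDiff

noncomputable section

/-- The open unit cube `(0,1)^n` in Euclidean space. -/
def unitCube (n : ℕ) : Set (EuclideanSpace ℝ (Fin n)) :=
  {x | ∀ i, x i ∈ Ioo (0 : ℝ) 1}

/-- `G` is a weak (distributional) derivative of the vector-valued map `u` on the set `U`:
`∫_U (∂_v φ) u = - ∫_U φ (G v)` for all test functions `φ ∈ C_c^∞(U)` and all directions `v`. -/
def HasWeakDerivOn {n : ℕ} (U : Set (EuclideanSpace ℝ (Fin n)))
    (u : EuclideanSpace ℝ (Fin n) → EuclideanSpace ℝ (Fin n))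
    (G : EuclideanSpace ℝ (Fin n) → (EuclideanSpace ℝ (Fin n) →L[ℝ] EuclideanSpace ℝ (Fin n))) :
    Prop :=
  LocallyIntegrableOn u U ∧ LocallyIntegrableOn G U ∧
    ∀ φ : EuclideanSpace ℝ (Fin n) → ℝ,
      ContDiff ℝ ∞ φ → HasCompactSupport φ → tsupport φ ⊆ U →
      ∀ v : EuclideanSpace ℝ (Fin n),
        ∫ x in U, (fderiv ℝ φ x v) • u x = - ∫ x in U, φ x • G x v

/-- The operator norm of a linear map, with respect to the Euclidean norm. -/
def operatorNorm (n : ℕ) (A : EuclideanSpace ℝ (Fin n) →L[ℝ] EuclideanSpace ℝ (Fin n)) : ℝ :=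
  ‖A‖

/-- The Euclidean (Frobenius, Hilbert-Schmidt) norm of a linear map: the square root of the sum of
the squares of its matrix entries. -/
def frobeniusNorm (n : ℕ) (A : EuclideanSpace ℝ (Fin n) →L[ℝ] EuclideanSpace ℝ (Fin n)) : ℝ :=
  Real.sqrt (∑ i, ∑ j, (A (EuclideanSpace.single j 1) i) ^ 2)

/-- A self-map of the unit cube, viewed as a map of the whole space. Only the values on the cube
are relevant; outside the cube we take the identity. -/
def cubeExtend {n : ℕ} (f : unitCube n → unitCube n) (x : EuclideanSpace ℝ (Fin n)) :
    EuclideanSpace ℝ (Fin n) :=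
  open Classical in if h : x ∈ unitCube n then (f ⟨x, h⟩ : EuclideanSpace ℝ (Fin n)) else x

/-- The space of homeomorphisms `f` of the open unit cube, in the Sobolev class `W^{1,p}`, which
have the identity as boundary values and satisfy `∫ |Df|^p ≤ M`, where `|·|` is the norm `N`. -/
structure SobolevHomeo (n : ℕ) (p M : ℝ)
    (N : (EuclideanSpace ℝ (Fin n) →L[ℝ] EuclideanSpace ℝ (Fin n)) → ℝ) where
  /-- the underlying homeomorphism of the open cube -/
  toHomeo : unitCube n ≃ₜ unitCube n
  /-- `f` extends continuously to the boundary by the identity -/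
  boundary : ∀ x ∈ frontier (unitCube n),
    Tendsto (fun y : unitCube n => (toHomeo y : EuclideanSpace ℝ (Fin n)))
      (comap Subtype.val (𝓝 x)) (𝓝 x)
  /-- `f` is in `W^{1,p}` and its energy is at most `M` -/
  sobolev : ∃ G : EuclideanSpace ℝ (Fin n) →
        (EuclideanSpace ℝ (Fin n) →L[ℝ] EuclideanSpace ℝ (Fin n)),
    HasWeakDerivOn (unitCube n) (cubeExtend toHomeo) G ∧
    MemLp (cubeExtend toHomeo) (ENNReal.ofReal p) (volume.restrict (unitCube n)) ∧
    MemLp G (ENNReal.ofReal p) (volume.restrict (unitCube n)) ∧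
    ∫ x in unitCube n, (N (G x)) ^ p ≤ M

/-- The Jacobian determinant of `f` (the determinant of its weak derivative, which is unique up to
null sets) vanishes almost everywhere in the cube. -/
def HasZeroJacobian {n : ℕ} (f : unitCube n → unitCube n) : Prop :=
  ∃ G : EuclideanSpace ℝ (Fin n) → (EuclideanSpace ℝ (Fin n) →L[ℝ] EuclideanSpace ℝ (Fin n)),
    HasWeakDerivOn (unitCube n) (cubeExtend f) G ∧
    ∀ᵐ x ∂(volume.restrict (unitCube n)), (G x).det = 0

/-- The supremum distance of two self-maps of the unit cube. -/
def supDist {n : ℕ} (f g : unitCube n → unitCube n) : ℝ :=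
  ⨆ x : unitCube n, ‖(f x : EuclideanSpace ℝ (Fin n)) - (g x : EuclideanSpace ℝ (Fin n))‖

theorem norm_le_of_mem_unitCube {n : ℕ} {x : EuclideanSpace ℝ (Fin n)} (hx : x ∈ unitCube n) :
    ‖x‖ ≤ Real.sqrt n := by
  rw [EuclideanSpace.norm_eq]
  apply Real.sqrt_le_sqrt
  calc ∑ i, ‖x i‖ ^ 2 ≤ ∑ _i : Fin n, (1 : ℝ) := by
        apply Finset.sum_le_sum
        intro i _
        have h := hx i
        rw [Real.norm_eq_abs, sq_abs]
        nlinarith [h.1, h.2]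
    _ = n := by simp

theorem bddAbove_supDist {n : ℕ} (f g : unitCube n → unitCube n) :
    BddAbove (range fun x : unitCube n =>
      ‖(f x : EuclideanSpace ℝ (Fin n)) - (g x : EuclideanSpace ℝ (Fin n))‖) := by
  refine ⟨Real.sqrt n + Real.sqrt n, ?_⟩
  rintro _ ⟨x, rfl⟩
  exact (norm_sub_le _ _).trans
    (add_le_add (norm_le_of_mem_unitCube (f x).2) (norm_le_of_mem_unitCube (g x).2))

theorem norm_sub_le_supDist {n : ℕ} (f g : unitCube n → unitCube n) (x : unitCube n) :
    ‖(f x : EuclideanSpace ℝ (Fin n)) - (g x : EuclideanSpace ℝ (Fin n))‖ ≤ supDist f g :=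
  le_ciSup (bddAbove_supDist f g) x

theorem supDist_nonneg {n : ℕ} (f g : unitCube n → unitCube n) : 0 ≤ supDist f g :=
  Real.iSup_nonneg fun _ => norm_nonneg _

theorem supDist_self {n : ℕ} (f : unitCube n → unitCube n) : supDist f f = 0 := by
  simp [supDist]

theorem supDist_comm {n : ℕ} (f g : unitCube n → unitCube n) : supDist f g = supDist g f := by
  unfold supDist
  congr 1
  ext x
  exact norm_sub_rev _ _

theorem supDist_triangle {n : ℕ} (f g h : unitCube n → unitCube n) :
    supDist f h ≤ supDist f g + supDist g h := by
  refine Real.iSup_le (fun x => ?_) (add_nonneg (supDist_nonneg _ _) (supDist_nonneg _ _))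
  exact (norm_sub_le_norm_sub_add_norm_sub _ _ _).trans
    (add_le_add (norm_sub_le_supDist f g x) (norm_sub_le_supDist g h x))

theorem eq_of_supDist_eq_zero {n : ℕ} {f g : unitCube n → unitCube n} (h : supDist f g = 0) :
    f = g := by
  ext1 x
  apply Subtype.ext
  rw [← sub_eq_zero, ← norm_eq_zero]
  exact le_antisymm (h ▸ norm_sub_le_supDist f g x) (norm_nonneg _)

/-- The metric `d(f,g) = ‖f - g‖_∞ + ‖f⁻¹ - g⁻¹‖_∞`. -/
instance SobolevHomeo.instMetricSpace (n : ℕ) (p M : ℝ)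
    (N : (EuclideanSpace ℝ (Fin n) →L[ℝ] EuclideanSpace ℝ (Fin n)) → ℝ) :
    MetricSpace (SobolevHomeo n p M N) where
  dist f g := supDist f.toHomeo g.toHomeo + supDist f.toHomeo.symm g.toHomeo.symm
  dist_self f := by simp [supDist_self]
  dist_comm f g := by
    rw [supDist_comm f.toHomeo g.toHomeo, supDist_comm f.toHomeo.symm g.toHomeo.symm]
  dist_triangle f g h := by
    linarith [supDist_triangle f.toHomeo g.toHomeo h.toHomeo,
      supDist_triangle f.toHomeo.symm g.toHomeo.symm h.toHomeo.symm]
  eq_of_dist_eq_zero := by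
    intro f g h
    have h1 : supDist f.toHomeo g.toHomeo = 0 :=
      le_antisymm
        ((le_add_of_nonneg_right (supDist_nonneg f.toHomeo.symm g.toHomeo.symm)).trans h.le)
        (supDist_nonneg _ _)
    have h2 : f.toHomeo = g.toHomeo := Homeomorph.ext (congrFun (eq_of_supDist_eq_zero h1))
    cases f
    cases g
    cases h2
    rfl

end

/-!
The set in question is even nowhere dense. Both norms have the form `N A = ‖L A‖` with `L` an
injective linear map, so they are treated together; `E f` denotes the energy `∫ ‖L (Df)‖ ^ p` over
the cube and `I` the identity matrix.

*The energy gap.* The trace of an arbitrary matrix is bounded by `√n` times its Frobenius norm, and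
so by `n` times its operator norm, with equality at `I`. For singular matrices the constants drop
to `√(n - 1)` and `√(n (n - 1))` (`coordTrace_le_of_det_eq_zero`). With Young's inequality this
places `‖L A‖ ^ p`, for singular `A`, above the affine function `‖L I‖ ^ p + κ (tr A - n)` by a
margin `c ‖L I‖ ^ p` with `c > 0` (`exists_energy_gap_operator`, `exists_energy_gap_frobenius`).
Upon integration over a region at whose boundary the map is close to the identity, the trace term
nearly vanishes: a map which has vanishing Jacobian and is close to the identity on a ball has
definitely more energy there than the identity (`exists_energy_gap_ball`). On the whole cube, the
existence of a map with vanishing Jacobian and energy at most `M` forces `E id < M`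
(`energy_id_lt_of_det_eq_zero`). Here it is used that the displacement `f - id` of a map with
identity boundary values, extended by zero, is weakly differentiable on the whole space
(`HasWeakDerivOn.univ_of_unitCube`).

*Maps of maximal energy are dense.* Given `E id < M`, conjugating a map `f` with a homothety of
ratio `s < 1` about the centre of the cube multiplies the excess `E f - E id` by `s ^ n`, changes
`f` and its inverse little, and leaves a map which is the identity near the boundary. There, a twist
in a small ball raises the energy continuously from its present value to arbitrarily large ones
(`exists_homeomorph_energy_excess_eq`), and can be chosen so that the energy becomes exactly `M`.
The resulting map `g` is close to `f`, has energy `M`, and is still the identity on another ball `B`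
(`SobolevHomeo.exists_dist_lt_energy_eq`).

*Conclusion.* A map `h` close to `g` with vanishing Jacobian would have definitely more energy than
`g` on `B`, and by lower semicontinuity (`exists_lt_setIntegral_of_uniformly_close`) hardly less
energy on the complement of `B`; its energy would exceed `M`. So a neighbourhood of `g` contains no
map with vanishing Jacobian.
-/

/-! ### The cube and the extension of its homeomorphisms by the identity -/

/-- Abbreviation for `n`-dimensional Euclidean space. -/
abbrev Euc (n : ℕ) := EuclideanSpace ℝ (Fin n)

theorem isOpen_unitCube (n : ℕ) : IsOpen (unitCube n) := by
  have : unitCube n = ⋂ i, (fun x : Euc n => x i) ⁻¹' Ioo 0 1 := by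
    ext x; simp [unitCube]
  rw [this]
  exact isOpen_iInter_of_finite fun i => isOpen_Ioo.preimage (by fun_prop)

theorem measurableSet_unitCube (n : ℕ) : MeasurableSet (unitCube n) :=
  (isOpen_unitCube n).measurableSet

theorem unitCube_subset_closedBall (n : ℕ) :
    unitCube n ⊆ Metric.closedBall (0 : Euc n) (Real.sqrt n) := fun x hx => by
  simpa using norm_le_of_mem_unitCube hx

theorem isBounded_unitCube (n : ℕ) : Bornology.IsBounded (unitCube n) :=
  Metric.isBounded_closedBall.subset (unitCube_subset_closedBall n)

theorem volume_cube (n : ℕ) (a b : ℝ) :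
    volume {x : Euc n | ∀ i, x i ∈ Ioo a b} = ENNReal.ofReal (b - a) ^ n := by
  have h : {x : Euc n | ∀ i, x i ∈ Ioo a b} =
      (WithLp.ofLp : Euc n → (Fin n → ℝ)) ⁻¹' (Set.pi univ fun _ => Ioo a b) := by
    ext x; simp
  rw [h, (PiLp.volume_preserving_ofLp (Fin n)).measure_preimage
    (MeasurableSet.univ_pi fun _ => measurableSet_Ioo).nullMeasurableSet, Real.volume_pi_Ioo]
  simp

theorem volume_unitCube (n : ℕ) : volume (unitCube n) = 1 := by
  have h := volume_cube n 0 1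
  rwa [sub_zero, ENNReal.ofReal_one, one_pow] at h

instance isFiniteMeasure_restrict_unitCube (n : ℕ) :
    IsFiniteMeasure ((volume : Measure (Euc n)).restrict (unitCube n)) :=
  ⟨by simp [volume_unitCube]⟩

theorem cubeExtend_of_mem {n : ℕ} (f : unitCube n → unitCube n) {x : Euc n}
    (hx : x ∈ unitCube n) : cubeExtend f x = f ⟨x, hx⟩ := by
  simp [cubeExtend, hx]

theorem cubeExtend_of_notMem {n : ℕ} (f : unitCube n → unitCube n) {x : Euc n}
    (hx : x ∉ unitCube n) : cubeExtend f x = x := by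
  simp [cubeExtend, hx]

theorem continuous_cubeExtend {n : ℕ} {f : unitCube n → unitCube n} (hf : Continuous f)
    (hb : ∀ x ∈ frontier (unitCube n),
      Tendsto (fun y : unitCube n => (f y : Euc n)) (comap Subtype.val (𝓝 x)) (𝓝 x)) :
    Continuous (cubeExtend f) := by
  have hres : (unitCube n).domRestrict (cubeExtend f) = fun y => (f y : Euc n) := by
    ext1 y; exact cubeExtend_of_mem f y.2
  rw [continuous_iff_continuousAt]
  intro x
  by_cases hx : x ∈ unitCube n
  · have : ContinuousOn (cubeExtend f) (unitCube n) := by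
      rw [continuousOn_iff_continuous_domRestrict, hres]; fun_prop
    exact this.continuousAt ((isOpen_unitCube n).mem_nhds hx)
  · rw [ContinuousAt, cubeExtend_of_notMem f hx]
    suffices h : Tendsto (cubeExtend f) (𝓝[unitCube n] x ⊔ 𝓝[(unitCube n)ᶜ] x) (𝓝 x) by
      rwa [← nhdsWithin_union, union_compl_self, nhdsWithin_univ] at h
    rw [tendsto_sup]
    constructor
    · by_cases hc : x ∈ closure (unitCube n)
      · have hfr : x ∈ frontier (unitCube n) := by
          rw [(isOpen_unitCube n).frontier_eq]; exact ⟨hc, hx⟩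
        have hm : 𝓝[unitCube n] x = map ((↑) : unitCube n → Euc n) (comap (↑) (𝓝 x)) := by
          rw [map_comap, Subtype.range_coe, nhdsWithin]
        rw [hm, tendsto_map'_iff]
        exact (hb x hfr).congr fun y => (congrFun hres y).symm
      · rw [mem_closure_iff_nhdsWithin_neBot, not_neBot] at hc
        rw [hc]; exact tendsto_bot
    · refine (tendsto_id.mono_left nhdsWithin_le_nhds).congr' ?_
      filter_upwards [self_mem_nhdsWithin] with y hy
      exact (cubeExtend_of_notMem f hy).symm

theorem cubeExtend_leftInverse {n : ℕ} (f : unitCube n ≃ₜ unitCube n) :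
    Function.LeftInverse (cubeExtend f.symm) (cubeExtend f) := fun x => by
  by_cases hx : x ∈ unitCube n
  · rw [cubeExtend_of_mem f hx, cubeExtend_of_mem f.symm (f ⟨x, hx⟩).2]; simp
  · rw [cubeExtend_of_notMem f hx, cubeExtend_of_notMem f.symm hx]

/-- The extension by the identity of a self-homeomorphism of the cube with identity boundary
values, as a homeomorphism of Euclidean space. The inverse is continuous because the extension,
being the identity off a bounded set, is a proper map. -/
theorem exists_homeomorph_cubeExtend {n : ℕ} (f : unitCube n ≃ₜ unitCube n)
    (hb : ∀ x ∈ frontier (unitCube n),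
      Tendsto (fun y : unitCube n => (f y : Euc n)) (comap Subtype.val (𝓝 x)) (𝓝 x)) :
    ∃ F : Euc n ≃ₜ Euc n, (∀ x, F x = cubeExtend f x) ∧ ∀ x, F.symm x = cubeExtend f.symm x := by
  have hc := continuous_cubeExtend f.continuous hb
  have hp : IsProperMap (cubeExtend f) := by
    rw [isProperMap_iff_tendsto_cocompact]
    refine ⟨hc, tendsto_id.congr' ?_⟩
    filter_upwards [(isCompact_closedBall (0 : Euc n) (Real.sqrt n)).compl_mem_cocompact] with x hx
    exact (cubeExtend_of_notMem f fun h => hx (unitCube_subset_closedBall n h)).symm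
  let e : Euc n ≃ Euc n :=
    ⟨cubeExtend f, cubeExtend f.symm, cubeExtend_leftInverse f, cubeExtend_leftInverse f.symm⟩
  exact ⟨e.toHomeomorphOfContinuousClosed hc hp.isClosedMap, fun _ => rfl, fun _ => rfl⟩

theorem mem_iff_of_eq_off {α : Type*} {s : Set α} (F : α ≃ α) (h : ∀ x ∉ s, F x = x) (x : α) :
    x ∈ s ↔ F x ∈ s := by
  constructor
  · intro hx
    by_contra hc
    have : x = F x := F.injective (h _ hc).symm
    exact hc (this ▸ hx)
  · intro hx
    by_contra hc
    exact hc (h x hc ▸ hx)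

/-- A homeomorphism of Euclidean space which is the identity off the cube restricts to a
self-homeomorphism of the cube with identity boundary values. -/
theorem exists_cube_homeomorph {n : ℕ} (F : Euc n ≃ₜ Euc n) (h : ∀ x ∉ unitCube n, F x = x) :
    ∃ f : unitCube n ≃ₜ unitCube n, (∀ x, cubeExtend f x = F x) ∧
      (∀ x, cubeExtend f.symm x = F.symm x) ∧
      ∀ x ∈ frontier (unitCube n),
        Tendsto (fun y : unitCube n => (f y : Euc n)) (comap Subtype.val (𝓝 x)) (𝓝 x) := by
  have h' : ∀ x ∉ unitCube n, F.symm x = x := fun x hx => by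
    conv_lhs => rw [← h x hx]
    simp
  refine ⟨F.subtype (mem_iff_of_eq_off F.toEquiv h), fun x => ?_, fun x => ?_, fun x hx => ?_⟩
  · by_cases hx : x ∈ unitCube n
    · rw [cubeExtend_of_mem _ hx]; rfl
    · rw [cubeExtend_of_notMem _ hx, h x hx]
  · by_cases hx : x ∈ unitCube n
    · rw [cubeExtend_of_mem _ hx]; rfl
    · rw [cubeExtend_of_notMem _ hx, h' x hx]
  · rw [(isOpen_unitCube n).frontier_eq] at hx
    have := F.continuous.tendsto x
    rw [h x hx.2] at this
    exact this.comp tendsto_comap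

theorem supDist_le_of_cubeExtend {n : ℕ} {f g : unitCube n → unitCube n} {ε : ℝ} (hε : 0 ≤ ε)
    (h : ∀ x ∈ unitCube n, ‖cubeExtend f x - cubeExtend g x‖ ≤ ε) : supDist f g ≤ ε :=
  Real.iSup_le (fun x => by
    have := h x x.2
    rwa [cubeExtend_of_mem f x.2, cubeExtend_of_mem g x.2] at this) hε

theorem norm_cubeExtend_sub_le {n : ℕ} (f g : unitCube n → unitCube n) (x : Euc n) :
    ‖cubeExtend f x - cubeExtend g x‖ ≤ supDist f g := by
  by_cases hx : x ∈ unitCube n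
  · rw [cubeExtend_of_mem f hx, cubeExtend_of_mem g hx]
    exact norm_sub_le_supDist f g ⟨x, hx⟩
  · rw [cubeExtend_of_notMem f hx, cubeExtend_of_notMem g hx]
    simpa using supDist_nonneg f g

/-! ### Weak derivatives -/

theorem integrable_smul_of_tsupport_subset {n : ℕ} {W : Type*} [NormedAddCommGroup W]
    [NormedSpace ℝ W] {U : Set (Euc n)} {w : Euc n → W} (hw : LocallyIntegrableOn w U)
    {φ : Euc n → ℝ} (hφ : Continuous φ) (hc : HasCompactSupport φ) (hs : tsupport φ ⊆ U) :
    Integrable fun x => φ x • w x := by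
  rw [← integrableOn_iff_integrable_of_support_subset (s := tsupport φ)]
  · exact (hw.integrableOn_compact_subset hs hc).continuousOn_smul hφ.continuousOn hc
  · exact (Function.support_smul_subset_left _ _).trans (subset_tsupport _)

theorem setIntegral_smul_of_tsupport_subset {n : ℕ} {W : Type*} [NormedAddCommGroup W]
    [NormedSpace ℝ W] {U : Set (Euc n)} (w : Euc n → W) {φ : Euc n → ℝ} (hs : tsupport φ ⊆ U) :
    ∫ x in U, φ x • w x = ∫ x, φ x • w x :=
  setIntegral_eq_integral_of_forall_compl_eq_zero fun x hx => by
    rw [image_eq_zero_of_notMem_tsupport fun h => hx (hs h), zero_smul]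

/-- The integration by parts identity, with both integrals over the whole space: the test function
vanishes off `U`. -/
theorem hasWeakDerivOn_iff {n : ℕ} {U : Set (Euc n)} {u : Euc n → Euc n}
    {G : Euc n → (Euc n →L[ℝ] Euc n)} :
    HasWeakDerivOn U u G ↔ LocallyIntegrableOn u U ∧ LocallyIntegrableOn G U ∧
      ∀ φ : Euc n → ℝ, ContDiff ℝ ∞ φ → HasCompactSupport φ → tsupport φ ⊆ U → ∀ v : Euc n,
        ∫ x, (fderiv ℝ φ x v) • u x = - ∫ x, φ x • G x v := by
  unfold HasWeakDerivOn
  refine and_congr_right fun _ => and_congr_right fun _ => forall_congr' fun φ =>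
    forall_congr' fun _ => forall_congr' fun _ => forall_congr' fun hs => forall_congr' fun v => ?_
  rw [setIntegral_smul_of_tsupport_subset u ((tsupport_fderiv_apply_subset ℝ v).trans hs),
    setIntegral_smul_of_tsupport_subset _ hs]

theorem HasWeakDerivOn.mono {n : ℕ} {U V : Set (Euc n)} {u : Euc n → Euc n}
    {G : Euc n → (Euc n →L[ℝ] Euc n)} (h : HasWeakDerivOn U u G) (hVU : V ⊆ U) :
    HasWeakDerivOn V u G := by
  rw [hasWeakDerivOn_iff] at h ⊢
  exact ⟨h.1.mono_set hVU, h.2.1.mono_set hVU, fun φ h1 h2 h3 v => h.2.2 φ h1 h2 (h3.trans hVU) v⟩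

theorem continuous_fderiv_apply_of_contDiff {n : ℕ} {φ : Euc n → ℝ} (hφ : ContDiff ℝ ∞ φ)
    (v : Euc n) : Continuous fun x => fderiv ℝ φ x v :=
  (hφ.continuous_fderiv (by simp)).clm_apply continuous_const

section TestFunction

variable {n : ℕ} {U : Set (Euc n)} {u w : Euc n → Euc n} {G H : Euc n → (Euc n →L[ℝ] Euc n)}
  {φ : Euc n → ℝ}

theorem HasWeakDerivOn.integrable_fderiv_smul (h : HasWeakDerivOn U u G) (hφ : ContDiff ℝ ∞ φ)
    (hc : HasCompactSupport φ) (hs : tsupport φ ⊆ U) (v : Euc n) :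
    Integrable fun x => (fderiv ℝ φ x v) • u x :=
  integrable_smul_of_tsupport_subset h.1 (continuous_fderiv_apply_of_contDiff hφ v)
    (hc.fderiv_apply (𝕜 := ℝ) v) ((tsupport_fderiv_apply_subset ℝ v).trans hs)

theorem HasWeakDerivOn.integrable_smul (h : HasWeakDerivOn U u G) (hφ : ContDiff ℝ ∞ φ)
    (hc : HasCompactSupport φ) (hs : tsupport φ ⊆ U) :
    Integrable fun x => φ x • G x :=
  integrable_smul_of_tsupport_subset h.2.1 hφ.continuous hc hs

theorem HasWeakDerivOn.integrable_smul_apply (h : HasWeakDerivOn U u G) (hφ : ContDiff ℝ ∞ φ)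
    (hc : HasCompactSupport φ) (hs : tsupport φ ⊆ U) (v : Euc n) :
    Integrable fun x => φ x • G x v :=
  (h.integrable_smul hφ hc hs).apply_continuousLinearMap v

theorem HasWeakDerivOn.add (h : HasWeakDerivOn U u G) (h' : HasWeakDerivOn U w H) :
    HasWeakDerivOn U (fun x => u x + w x) (fun x => G x + H x) := by
  rw [hasWeakDerivOn_iff]
  refine ⟨LocallyIntegrableOn.add h.1 h'.1, LocallyIntegrableOn.add (f := G) (g := H) h.2.1 h'.2.1,
    fun φ hφ hc hs v => ?_⟩
  have e1 := (hasWeakDerivOn_iff.1 h).2.2 φ hφ hc hs v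
  have e2 := (hasWeakDerivOn_iff.1 h').2.2 φ hφ hc hs v
  simp only [smul_add, add_apply]
  rw [integral_add (h.integrable_fderiv_smul hφ hc hs v) (h'.integrable_fderiv_smul hφ hc hs v),
    integral_add (h.integrable_smul_apply hφ hc hs v) (h'.integrable_smul_apply hφ hc hs v),
    e1, e2, neg_add]

/-- Uniformly close maps have weak derivatives that are close in the sense of distributions. -/
theorem HasWeakDerivOn.norm_integral_smul_sub_le (h : HasWeakDerivOn U u G)
    (h' : HasWeakDerivOn U w H) (hφ : ContDiff ℝ ∞ φ) (hc : HasCompactSupport φ)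
    (hs : tsupport φ ⊆ U) {ε : ℝ} (hε : ∀ x ∈ U, ‖u x - w x‖ ≤ ε) :
    ‖∫ x, φ x • (G x - H x)‖ ≤ ε * ∫ x, ‖fderiv ℝ φ x‖ := by
  by_cases hU : U.Nonempty
  swap
  · have h0 : ∀ x, φ x = 0 := fun x => by
      by_contra hx
      exact hU ⟨x, hs (subset_tsupport _ hx)⟩
    have h1 : (fun x => φ x • (G x - H x)) = fun _ => 0 := by
      ext1 x; ext1 v; rw [smul_apply, h0, zero_smul, zero_apply]
    have h2 : fderiv ℝ φ = 0 := by
      rw [show φ = fun _ => 0 from funext h0]; exact fderiv_fun_const 0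
    simp [h1, h2]
  have hε0 : 0 ≤ ε := (norm_nonneg _).trans (hε _ hU.some_mem)
  have hint : Integrable fun x => ‖fderiv ℝ φ x‖ :=
    ((hφ.continuous_fderiv (by simp)).integrable_of_hasCompactSupport (hc.fderiv ℝ)).norm
  refine ContinuousLinearMap.opNorm_le_bound _
    (mul_nonneg hε0 (integral_nonneg fun _ => norm_nonneg _)) fun v => ?_
  have hGH : Integrable fun x => φ x • (G x - H x) := by
    simpa only [smul_sub] using! (h.integrable_smul hφ hc hs).sub (h'.integrable_smul hφ hc hs)
  have e : (∫ x, φ x • (G x - H x)) v = - ∫ x, (fderiv ℝ φ x v) • (u x - w x) := by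
    rw [ContinuousLinearMap.integral_apply hGH]
    simp only [smul_sub, smul_apply, sub_apply]
    rw [integral_sub (h.integrable_fderiv_smul hφ hc hs v) (h'.integrable_fderiv_smul hφ hc hs v),
      integral_sub (h.integrable_smul_apply hφ hc hs v) (h'.integrable_smul_apply hφ hc hs v),
      (hasWeakDerivOn_iff.1 h).2.2 φ hφ hc hs v, (hasWeakDerivOn_iff.1 h').2.2 φ hφ hc hs v]
    abel
  rw [e, norm_neg]
  calc ‖∫ x, (fderiv ℝ φ x v) • (u x - w x)‖
      ≤ ∫ x, (ε * ‖v‖) * ‖fderiv ℝ φ x‖ := by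
        refine norm_integral_le_of_norm_le (hint.const_mul _) (Eventually.of_forall fun x => ?_)
        by_cases hx : x ∈ U
        · rw [norm_smul]
          calc ‖fderiv ℝ φ x v‖ * ‖u x - w x‖ ≤ (‖fderiv ℝ φ x‖ * ‖v‖) * ε := by
                gcongr
                · exact ContinuousLinearMap.le_opNorm _ _
                · exact hε x hx
            _ = _ := by ring
        · rw [fderiv_of_notMem_tsupport ℝ fun h => hx (hs h)]
          simp
    _ = _ := by rw [integral_const_mul]; ring

/-- The weak derivative on an open set is unique up to null sets. -/
theorem HasWeakDerivOn.ae_eq (hU : IsOpen U) (h : HasWeakDerivOn U u G)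
    (h' : HasWeakDerivOn U u H) : ∀ᵐ x ∂(volume.restrict U), G x = H x := by
  rw [ae_restrict_iff' hU.measurableSet]
  have := hU.ae_eq_zero_of_integral_contDiff_smul_eq_zero (μ := volume)
    (f := fun x => G x - H x) (h.2.1.sub h'.2.1) fun φ hφ hc hs => by
      have := h.norm_integral_smul_sub_le h' hφ hc hs (ε := 0) (by simp)
      simpa using this
  filter_upwards [this] with x hx hxU
  exact sub_eq_zero.1 (hx hxU)

end TestFunction

theorem hasWeakDerivOn_fderiv {n : ℕ} {f : Euc n → Euc n} (hf : ContDiff ℝ 1 f) :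
    HasWeakDerivOn univ f (fderiv ℝ f) := by
  have hcd : Continuous (fderiv ℝ f) := hf.continuous_fderiv (by simp)
  rw [hasWeakDerivOn_iff]
  refine ⟨hf.continuous.locallyIntegrable.locallyIntegrableOn _,
    hcd.locallyIntegrable.locallyIntegrableOn _, fun φ hφ hc _ v => ?_⟩
  have hd : Differentiable ℝ f := hf.differentiable (by simp)
  have := integral_smul_fderiv_eq_neg_fderiv_smul_of_integrable (μ := (volume : Measure (Euc n)))
    (f := φ) (g := f) (v := v)
    (((continuous_fderiv_apply_of_contDiff hφ v).smul hf.continuous).integrable_of_hasCompactSupport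
      (hc.fderiv_apply (𝕜 := ℝ) v).smul_right)
    ((hφ.continuous.smul (hcd.clm_apply continuous_const)).integrable_of_hasCompactSupport
      hc.smul_right)
    ((hφ.continuous.smul hf.continuous).integrable_of_hasCompactSupport hc.smul_right)
    (fun x _ => (hφ.differentiable (by simp)).differentiableAt) (fun x _ => hd.differentiableAt)
  rw [this, neg_neg]

theorem hasWeakDerivOn_id {n : ℕ} :
    HasWeakDerivOn univ (fun x : Euc n => x) (fun _ => ContinuousLinearMap.id ℝ (Euc n)) := by
  have := hasWeakDerivOn_fderiv (contDiff_id (𝕜 := ℝ) (E := Euc n) (n := 1))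
  have e : fderiv ℝ (id : Euc n → Euc n) = fun _ => ContinuousLinearMap.id ℝ (Euc n) := by
    ext1 x; exact fderiv_id
  rwa [e] at this

/-- The homothety `x ↦ c + s (x - c)` of ratio `s` with centre `c`. -/
def homothetyAt {n : ℕ} (c : Euc n) (s : ℝ) (x : Euc n) : Euc n := c + s • (x - c)

theorem integral_comp_homothetyAt {n : ℕ} {W : Type*} [NormedAddCommGroup W] [NormedSpace ℝ W]
    (c : Euc n) {s : ℝ} (hs : 0 < s) (f : Euc n → W) :
    ∫ x, f (homothetyAt c s⁻¹ x) = s ^ n • ∫ x, f x := by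
  unfold homothetyAt
  rw [integral_sub_right_eq_self (fun x => f (c + s⁻¹ • x)) c,
    Measure.integral_comp_inv_smul_of_nonneg _ (fun x => f (c + x)) hs.le,
    integral_add_left_eq_self f c]
  simp

theorem homothetyAt_inv_cancel {n : ℕ} (c : Euc n) {s : ℝ} (hs : s ≠ 0) (x : Euc n) :
    homothetyAt c s (homothetyAt c s⁻¹ x) = x := by
  simp [homothetyAt, smul_smul, hs]

theorem homothetyAt_cancel {n : ℕ} (c : Euc n) {s : ℝ} (hs : s ≠ 0) (x : Euc n) :
    homothetyAt c s⁻¹ (homothetyAt c s x) = x := by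
  simp [homothetyAt, smul_smul, hs]

theorem contDiff_homothetyAt {n : ℕ} (c : Euc n) (s : ℝ) {m : WithTop ℕ∞} :
    ContDiff ℝ m (homothetyAt c s) := by
  unfold homothetyAt; fun_prop

theorem continuous_homothetyAt {n : ℕ} (c : Euc n) (s : ℝ) :
    Continuous (homothetyAt c s) := (contDiff_homothetyAt c s (m := 0)).continuous

theorem hasFDerivAt_homothetyAt {n : ℕ} (c : Euc n) (s : ℝ) (x : Euc n) :
    HasFDerivAt (homothetyAt c s) (s • ContinuousLinearMap.id ℝ (Euc n)) x := by
  unfold homothetyAt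
  exact (((hasFDerivAt_id x).sub_const c).const_smul s).const_add c

/-- The homothety as a homeomorphism. -/
noncomputable def homothetyHomeo {n : ℕ} (c : Euc n) {s : ℝ} (hs : s ≠ 0) : Euc n ≃ₜ Euc n where
  toFun := homothetyAt c s
  invFun := homothetyAt c s⁻¹
  left_inv := homothetyAt_cancel c hs
  right_inv := homothetyAt_inv_cancel c hs
  continuous_toFun := continuous_homothetyAt c s
  continuous_invFun := continuous_homothetyAt c s⁻¹

theorem integrable_comp_homothetyAt {n : ℕ} {W : Type*} [NormedAddCommGroup W] [NormedSpace ℝ W]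
    (c : Euc n) {s : ℝ} (hs : 0 < s) {f : Euc n → W} (hf : Integrable f) :
    Integrable fun x => f (homothetyAt c s⁻¹ x) := by
  unfold homothetyAt
  have h1 := hf.comp_add_left c
  have h2 := h1.comp_smul (inv_ne_zero hs.ne')
  exact h2.comp_sub_right c

/-- Rescaling the displacement `u` of a map by a homothety rescales its weak derivative. -/
theorem HasWeakDerivOn.comp_homothetyAt {n : ℕ} {u : Euc n → Euc n}
    {K : Euc n → (Euc n →L[ℝ] Euc n)} (h : HasWeakDerivOn univ u K) (hu : Continuous u)
    (hK : Integrable K) (c : Euc n) {s : ℝ} (hs : 0 < s) :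
    HasWeakDerivOn univ (fun x => s • u (homothetyAt c s⁻¹ x))
      (fun x => K (homothetyAt c s⁻¹ x)) := by
  rw [hasWeakDerivOn_iff]
  have hcont := (hu.comp (continuous_homothetyAt c s⁻¹)).const_smul s
  refine ⟨hcont.locallyIntegrable.locallyIntegrableOn _,
    (integrable_comp_homothetyAt c hs hK).locallyIntegrable.locallyIntegrableOn _,
    fun φ hφ hc _ v => ?_⟩
  have hψ : ContDiff ℝ ∞ fun x => φ (homothetyAt c s x) := hφ.comp (contDiff_homothetyAt c s)
  have hψc : HasCompactSupport fun x => φ (homothetyAt c s x) :=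
    hc.comp_isClosedEmbedding (homothetyHomeo c hs.ne').isClosedEmbedding
  have hfd : ∀ x, fderiv ℝ (fun x => φ (homothetyAt c s x)) x v =
      s • fderiv ℝ φ (homothetyAt c s x) v := fun x => by
    have := ((hφ.differentiable (by simp)).differentiableAt.hasFDerivAt
      (x := homothetyAt c s x)).comp x (hasFDerivAt_homothetyAt c s x)
    have e := this.fderiv
    change fderiv ℝ (φ ∘ homothetyAt c s) x v = _
    rw [e]; simp
  have key := (hasWeakDerivOn_iff.1 h).2.2 _ hψ hψc (subset_univ _) v
  have h1 := integral_comp_homothetyAt c hs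
    fun x => (fderiv ℝ (fun x => φ (homothetyAt c s x)) x v) • u x
  have h2 := integral_comp_homothetyAt c hs fun x => φ (homothetyAt c s x) • K x v
  simp only [hfd, homothetyAt_inv_cancel c hs.ne'] at h1 h2 key
  calc ∫ x, fderiv ℝ φ x v • s • u (homothetyAt c s⁻¹ x)
      = ∫ x, (s • fderiv ℝ φ x v) • u (homothetyAt c s⁻¹ x) := by
        congr 1; ext1 x; rw [smul_assoc, smul_comm]
    _ = _ := by rw [h1, h2, key, smul_neg]

/-! ### Extension of weak derivatives across the boundary of the cube -/

theorem exists_bound_deriv_smoothTransition :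
    ∃ C : ℝ, 0 ≤ C ∧ ∀ s, |deriv Real.smoothTransition s| ≤ C := by
  have hcont : Continuous (deriv Real.smoothTransition) :=
    (Real.smoothTransition.contDiff (n := 1)).continuous_deriv le_rfl
  obtain ⟨C, hC⟩ := (isCompact_Icc (a := (0 : ℝ)) (b := 1)).exists_bound_of_continuousOn
    hcont.continuousOn
  refine ⟨max C 0, le_max_right _ _, fun s => ?_⟩
  rcases lt_or_ge s 0 with h0 | h0
  · have : Real.smoothTransition =ᶠ[𝓝 s] fun _ => 0 := by
      filter_upwards [Iio_mem_nhds h0] with t ht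
      exact Real.smoothTransition.zero_of_nonpos ht.le
    simp [this.deriv_eq]
  rcases lt_or_ge 1 s with h1 | h1
  · have : Real.smoothTransition =ᶠ[𝓝 s] fun _ => 1 := by
      filter_upwards [Ioi_mem_nhds h1] with t ht
      exact Real.smoothTransition.one_of_one_le ht.le
    simp [this.deriv_eq]
  exact (hC s ⟨h0, h1⟩).trans (le_max_left _ _)

/-- Smooth cutoffs of an interval, with derivative bounded by the inverse of the width of the
transition layer. -/
theorem exists_interval_cutoff :
    ∃ C : ℝ, 0 ≤ C ∧ ∀ δ : ℝ, 0 < δ → ∃ χ : ℝ → ℝ, ContDiff ℝ ∞ χ ∧ (∀ s, 0 ≤ χ s ∧ χ s ≤ 1) ∧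
      (∀ s, χ s ≠ 0 → s ∈ Icc δ (1 - δ)) ∧ (∀ s ∈ Ioo (2 * δ) (1 - 2 * δ), χ s = 1) ∧
      ∀ s, |deriv χ s| ≤ C / δ := by
  obtain ⟨C, hC0, hC⟩ := exists_bound_deriv_smoothTransition
  refine ⟨2 * C, by positivity, fun δ hδ => ⟨fun s =>
    Real.smoothTransition (s / δ - 1) * Real.smoothTransition ((1 - s) / δ - 1),
    ?_, ?_, ?_, ?_, ?_⟩⟩
  · exact (Real.smoothTransition.contDiff.comp (by fun_prop)).mul
      (Real.smoothTransition.contDiff.comp (by fun_prop))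
  · exact fun s => ⟨mul_nonneg (Real.smoothTransition.nonneg _) (Real.smoothTransition.nonneg _),
      mul_le_one₀ (Real.smoothTransition.le_one _) (Real.smoothTransition.nonneg _)
        (Real.smoothTransition.le_one _)⟩
  · intro s hs
    constructor
    · by_contra! h
      refine hs (mul_eq_zero_of_left (Real.smoothTransition.zero_of_nonpos ?_) _)
      have := (div_le_one hδ).2 h.le
      linarith
    · by_contra! h
      refine hs (mul_eq_zero_of_right _ (Real.smoothTransition.zero_of_nonpos ?_))
      have := (div_le_one hδ).2 (show 1 - s ≤ δ by linarith)
      linarith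
  · intro s hs
    have h1 : 1 ≤ s / δ - 1 := by
      have := (le_div_iff₀ hδ).2 hs.1.le
      linarith
    have h2 : 1 ≤ (1 - s) / δ - 1 := by
      have := (le_div_iff₀ hδ).2 (show 2 * δ ≤ 1 - s by linarith [hs.2])
      linarith
    simp only [Real.smoothTransition.one_of_one_le h1, Real.smoothTransition.one_of_one_le h2,
      mul_one]
  · intro s
    have hd : Differentiable ℝ Real.smoothTransition :=
      (Real.smoothTransition.contDiff (n := 1)).differentiable (by simp)
    have h1 : HasDerivAt (fun s => Real.smoothTransition (s / δ - 1))
        (deriv Real.smoothTransition (s / δ - 1) * (1 / δ)) s :=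
      (hd _).hasDerivAt.comp s (((hasDerivAt_id s).div_const δ).sub_const 1)
    have h2 : HasDerivAt (fun s => Real.smoothTransition ((1 - s) / δ - 1))
        (deriv Real.smoothTransition ((1 - s) / δ - 1) * (-1 / δ)) s :=
      (hd _).hasDerivAt.comp s ((((hasDerivAt_id s).const_sub 1).div_const δ).sub_const 1)
    rw [(h1.fun_mul h2).deriv]
    have hb : ∀ a c e : ℝ, |a| ≤ C → 0 ≤ c → c ≤ 1 → |e| = 1 → |a * (e / δ) * c| ≤ C / δ := by
      intro a c e ha hc0 hc1 he
      rw [abs_mul, abs_mul, abs_div, he, abs_of_pos hδ, abs_of_nonneg hc0]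
      calc |a| * (1 / δ) * c ≤ C * (1 / δ) * 1 := by gcongr
        _ = C / δ := by ring
    have e1 := hb _ _ 1 (hC (s / δ - 1)) (Real.smoothTransition.nonneg ((1 - s) / δ - 1))
      (Real.smoothTransition.le_one _) (by simp)
    have e2 := hb _ _ (-1) (hC ((1 - s) / δ - 1)) (Real.smoothTransition.nonneg (s / δ - 1))
      (Real.smoothTransition.le_one _) (by simp)
    rw [mul_comm (Real.smoothTransition (s / δ - 1))]
    refine (abs_add_le _ _).trans ?_
    calc _ ≤ C / δ + C / δ := add_le_add e1 e2
      _ = _ := by ring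

/-- Smooth cutoffs of the cube, with gradient bounded by the inverse of the width of the transition
layer. -/
theorem exists_cube_cutoff (n : ℕ) :
    ∃ C : ℝ, 0 ≤ C ∧ ∀ δ : ℝ, 0 < δ → ∃ η : Euc n → ℝ, ContDiff ℝ ∞ η ∧ HasCompactSupport η ∧
      tsupport η ⊆ unitCube n ∧ (∀ x, 0 ≤ η x ∧ η x ≤ 1) ∧
      (∀ x : Euc n, (∀ i, x i ∈ Ioo (2 * δ) (1 - 2 * δ)) → η x = 1) ∧
      ∀ x, ‖fderiv ℝ η x‖ ≤ C / δ := by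
  obtain ⟨C, hC0, hC⟩ := exists_interval_cutoff
  refine ⟨n * C, by positivity, fun δ hδ => ?_⟩
  obtain ⟨χ, hχ, hχ01, hχ0, hχ1, hχd⟩ := hC δ hδ
  have hcl : IsClosed {x : Euc n | ∀ i, x i ∈ Icc δ (1 - δ)} := by
    have : {x : Euc n | ∀ i, x i ∈ Icc δ (1 - δ)} =
        ⋂ i, (fun x : Euc n => x i) ⁻¹' Icc δ (1 - δ) := by ext x; simp
    rw [this]
    exact isClosed_iInter fun i => isClosed_Icc.preimage (by fun_prop)
  have hsupp : tsupport (fun x : Euc n => ∏ i, χ (x i)) ⊆ {x | ∀ i, x i ∈ Icc δ (1 - δ)} :=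
    closure_minimal (fun x hx i => hχ0 _ fun h => hx (Finset.prod_eq_zero (Finset.mem_univ i) h))
      hcl
  have hsub : {x : Euc n | ∀ i, x i ∈ Icc δ (1 - δ)} ⊆ unitCube n := fun x hx i =>
    ⟨hδ.trans_le (hx i).1, (hx i).2.trans_lt (by linarith)⟩
  refine ⟨fun x => ∏ i, χ (x i), ?_, ?_, hsupp.trans hsub, fun x => ⟨?_, ?_⟩, ?_, fun x => ?_⟩
  · exact contDiff_prod fun i _ => hχ.comp (by fun_prop)
  · exact Metric.isCompact_of_isClosed_isBounded (isClosed_tsupport _)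
      ((isBounded_unitCube n).subset (hsupp.trans hsub))
  · exact Finset.prod_nonneg fun i _ => (hχ01 _).1
  · exact Finset.prod_le_one (fun i _ => (hχ01 _).1) fun i _ => (hχ01 _).2
  · exact fun x hx => Finset.prod_eq_one fun i _ => hχ1 _ (hx i)
  · have h1 : ∀ i ∈ (Finset.univ : Finset (Fin n)), HasFDerivAt (fun x : Euc n => χ (x i))
        (deriv χ (x i) • (EuclideanSpace.proj i : Euc n →L[ℝ] ℝ)) x := fun i _ =>
      ((hχ.differentiable (by simp)) (x i)).hasDerivAt.comp_hasFDerivAt x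
        (EuclideanSpace.proj i : Euc n →L[ℝ] ℝ).hasFDerivAt
    rw [(HasFDerivAt.finsetProd h1).fderiv]
    calc _ ≤ ∑ _i : Fin n, C / δ := by
          refine norm_sum_le_of_le _ fun i _ => ?_
          refine ContinuousLinearMap.opNorm_le_bound _ (by positivity) fun v => ?_
          rw [smul_apply, smul_apply, norm_smul, norm_smul]
          have hp : ‖∏ j ∈ Finset.univ.erase i, χ (x j)‖ ≤ 1 := by
            rw [Real.norm_eq_abs, abs_of_nonneg (Finset.prod_nonneg fun i _ => (hχ01 _).1)]
            exact Finset.prod_le_one (fun i _ => (hχ01 _).1) fun i _ => (hχ01 _).2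
          have hv : ‖(EuclideanSpace.proj i : Euc n →L[ℝ] ℝ) v‖ ≤ ‖v‖ := PiLp.norm_apply_le v i
          calc _ ≤ 1 * (C / δ * ‖v‖) := by
                gcongr
                exact hχd _
            _ = _ := one_mul _
      _ = n * C / δ := by simp; ring

theorem volume_boundary_layer_le (n : ℕ) {δ : ℝ} (hδ : 0 < δ) (hδ' : δ < 1 / 4) :
    volume.real (unitCube n \ {x : Euc n | ∀ i, x i ∈ Ioo (2 * δ) (1 - 2 * δ)}) ≤ 4 * n * δ := by
  have hsub : {x : Euc n | ∀ i, x i ∈ Ioo (2 * δ) (1 - 2 * δ)} ⊆ unitCube n := fun x hx i =>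
    ⟨by linarith [(hx i).1], by linarith [(hx i).2]⟩
  have hm : MeasurableSet {x : Euc n | ∀ i, x i ∈ Ioo (2 * δ) (1 - 2 * δ)} := by
    have : {x : Euc n | ∀ i, x i ∈ Ioo (2 * δ) (1 - 2 * δ)} =
        ⋂ i, (fun x : Euc n => x i) ⁻¹' Ioo (2 * δ) (1 - 2 * δ) := by ext x; simp
    rw [this]
    exact (isOpen_iInter_of_finite fun i => isOpen_Ioo.preimage (by fun_prop)).measurableSet
  rw [measureReal_sdiff hsub hm (by simp [volume_unitCube]), measureReal_def, measureReal_def,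
    volume_unitCube, volume_cube]
  have h1 : (ENNReal.ofReal (1 - 2 * δ - 2 * δ) ^ n).toReal = (1 + -(4 * δ)) ^ n := by
    rw [ENNReal.toReal_pow, ENNReal.toReal_ofReal (by linarith)]
    ring
  have h2 := one_add_mul_le_pow (show (-2 : ℝ) ≤ -(4 * δ) by linarith) n
  rw [h1, ENNReal.toReal_one]
  linarith

/-- A map vanishing continuously on the boundary of the cube, whose weak derivative in the cube is
integrable, can be extended by zero without creating a singular part of the derivative. The error
made by cutting off at distance `δ` from the boundary is the product of the size `1/δ` of the
gradient of the cutoff, the volume `O(δ)` of the layer, and the size `o(1)` of the map there. -/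
theorem HasWeakDerivOn.univ_of_unitCube {n : ℕ} {u : Euc n → Euc n}
    {K : Euc n → (Euc n →L[ℝ] Euc n)} (h : HasWeakDerivOn (unitCube n) u K)
    (hu : Continuous u) (hu0 : ∀ x ∉ unitCube n, u x = 0) (hK : Integrable K)
    (hK0 : ∀ x ∉ unitCube n, K x = 0) : HasWeakDerivOn univ u K := by
  rw [hasWeakDerivOn_iff]
  refine ⟨hu.locallyIntegrable.locallyIntegrableOn _, hK.locallyIntegrable.locallyIntegrableOn _,
    fun φ hφ hc _ v => ?_⟩
  obtain ⟨C, hC0, hC⟩ := exists_cube_cutoff n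
  have hδ : ∀ k : ℕ, (0 : ℝ) < 1 / (k + 5) := fun k => by positivity
  have hδlim : Tendsto (fun k : ℕ => (1 : ℝ) / (k + 5)) atTop (𝓝 0) := by
    have := (tendsto_one_div_add_atTop_nhds_zero_nat (𝕜 := ℝ)).comp (tendsto_add_atTop_nat 4)
    refine this.congr fun k => ?_
    simp only [Function.comp, Nat.cast_add, Nat.cast_ofNat]
    ring
  choose η hη hηc hηs hη01 hη1 hηd using fun k : ℕ => hC _ (hδ k)
  have hlim : ∀ x ∈ unitCube n, ∀ᶠ k in atTop, η k x = 1 := by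
    intro x hx
    have : ∀ i, ∀ᶠ k : ℕ in atTop, x i ∈ Ioo (2 * (1 / ((k : ℝ) + 5))) (1 - 2 * (1 / (k + 5))) := by
      intro i
      have h2 := hδlim.const_mul 2
      rw [mul_zero] at h2
      filter_upwards [h2.eventually_lt_const (hx i).1,
        h2.eventually_lt_const (sub_pos.2 (hx i).2)] with k h3 h4
      exact ⟨h3, by linarith⟩
    filter_upwards [eventually_all.2 this] with k hk
    exact hη1 k x hk
  -- the three terms of the identity for the test function `φ * η k`
  have hid : ∀ k, ∫ x, η k x • (fderiv ℝ φ x v • u x) =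
      -(∫ x, η k x • (φ x • K x v)) - ∫ x, (φ x * fderiv ℝ (η k) x v) • u x := by
    intro k
    have hs : tsupport (fun x => φ x * η k x) ⊆ unitCube n :=
      (tsupport_mul_subset_right).trans (hηs k)
    have e := (hasWeakDerivOn_iff.1 h).2.2 (fun x => φ x * η k x) (hφ.mul (hη k))
      hc.mul_right hs v
    have hfd : ∀ x, fderiv ℝ (fun x => φ x * η k x) x v • u x =
        η k x • (fderiv ℝ φ x v • u x) + (φ x * fderiv ℝ (η k) x v) • u x := fun x => by
      rw [fderiv_fun_mul ((hφ.differentiable (by simp)) x) (((hη k).differentiable (by simp)) x)]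
      simp only [add_apply, smul_apply, smul_eq_mul, smul_smul, ← add_smul]
      congr 1
      ring
    have hi1 : Integrable fun x => η k x • (fderiv ℝ φ x v • u x) :=
      ((hη k).continuous.smul ((continuous_fderiv_apply_of_contDiff hφ v).smul
        hu)).integrable_of_hasCompactSupport
        (hηc k).smul_right
    have hi2 : Integrable fun x => (φ x * fderiv ℝ (η k) x v) • u x :=
      ((hφ.continuous.mul (continuous_fderiv_apply_of_contDiff (hη k) v)).smul
        hu).integrable_of_hasCompactSupport hc.mul_right.smul_right
    simp only [hfd] at e
    rw [integral_add hi1 hi2] at e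
    rw [eq_sub_iff_add_eq, e]
    congr 2
    ext1 x
    rw [smul_smul, mul_comm]
  have hdct : ∀ f : Euc n → Euc n, Integrable f → (∀ x ∉ unitCube n, f x = 0) →
      Tendsto (fun k => ∫ x, η k x • f x) atTop (𝓝 (∫ x, f x)) := by
    intro f hf hf0
    refine tendsto_integral_of_dominated_convergence (fun x => ‖f x‖)
      (fun k => (hη k).continuous.aestronglyMeasurable.smul hf.1) hf.norm
      (fun k => Eventually.of_forall fun x => ?_) (Eventually.of_forall fun x => ?_)
    · rw [norm_smul, Real.norm_eq_abs, abs_of_nonneg (hη01 k x).1]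
      exact mul_le_of_le_one_left (norm_nonneg _) (hη01 k x).2
    · by_cases hx : x ∈ unitCube n
      · refine tendsto_const_nhds.congr' ?_
        filter_upwards [hlim x hx] with k hk
        rw [hk, one_smul]
      · simp [hf0 x hx]
  have t1 := hdct (fun x => fderiv ℝ φ x v • u x)
    (((continuous_fderiv_apply_of_contDiff hφ v).smul hu).integrable_of_hasCompactSupport
      (hc.fderiv_apply (𝕜 := ℝ) v).smul_right) (fun x hx => by simp [hu0 x hx])
  have t2 := hdct (fun x => φ x • K x v)
    (integrable_smul_of_tsupport_subset
      ((hK.apply_continuousLinearMap v).locallyIntegrable.locallyIntegrableOn univ)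
      hφ.continuous hc (subset_univ _)) (fun x hx => by simp [hK0 x hx])
  have t3 : Tendsto (fun k => ∫ x, (φ x * fderiv ℝ (η k) x v) • u x) atTop (𝓝 0) := by
    obtain ⟨B, hB⟩ := hφ.continuous.bounded_above_of_compact_support hc
    have hB0 : 0 ≤ B := (norm_nonneg _).trans (hB 0)
    have hucs : HasCompactSupport u := HasCompactSupport.of_support_subset_isCompact
      (isCompact_closedBall (0 : Euc n) (Real.sqrt n)) fun x hx =>
        unitCube_subset_closedBall n (by_contra fun h => hx (hu0 x h))
    have huc : UniformContinuous u := hucs.uniformContinuous_of_continuous hu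
    set D : ℝ := B * (C * ‖v‖) * (4 * n) with hD
    have hD0 : 0 ≤ D := by positivity
    rw [Metric.tendsto_atTop']
    intro ε hε
    obtain ⟨ρ, hρ, hρu⟩ := Metric.uniformContinuous_iff.1 huc (ε / (D + 1)) (by positivity)
    have h2 := hδlim.const_mul 2
    rw [mul_zero] at h2
    obtain ⟨N, hN⟩ := eventually_atTop.1 (h2.eventually_lt_const hρ)
    refine ⟨N, fun k hk => ?_⟩
    have hkρ := hN k hk.le
    set δ : ℝ := 1 / ((k : ℝ) + 5) with hδk
    have hδ0 : 0 < δ := hδ k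
    have hδ4 : δ < 1 / 4 := by
      rw [hδk]; gcongr; linarith [(Nat.cast_nonneg k : (0 : ℝ) ≤ k)]
    set S := unitCube n \ {x : Euc n | ∀ i, x i ∈ Ioo (2 * δ) (1 - 2 * δ)} with hS
    have hopen : IsOpen {x : Euc n | ∀ i, x i ∈ Ioo (2 * δ) (1 - 2 * δ)} := by
      have : {x : Euc n | ∀ i, x i ∈ Ioo (2 * δ) (1 - 2 * δ)} =
          ⋂ i, (fun x : Euc n => x i) ⁻¹' Ioo (2 * δ) (1 - 2 * δ) := by ext x; simp
      rw [this]
      exact isOpen_iInter_of_finite fun i => isOpen_Ioo.preimage (by fun_prop)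
    have hoff : ∀ x ∉ S, (φ x * fderiv ℝ (η k) x v) • u x = 0 := by
      intro x hx
      by_cases hxQ : x ∈ unitCube n
      · have hx' : x ∈ {x : Euc n | ∀ i, x i ∈ Ioo (2 * δ) (1 - 2 * δ)} := by
          by_contra hc; exact hx ⟨hxQ, hc⟩
        have : η k =ᶠ[𝓝 x] fun _ => 1 := by
          filter_upwards [hopen.mem_nhds hx'] with y hy
          exact hη1 k y hy
        simp [this.fderiv_eq]
      · simp [hu0 x hxQ]
    have hsmall : ∀ x ∈ S, ‖u x‖ ≤ ε / (D + 1) := by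
      intro x hx
      have hx2 : ∃ i, x i ∉ Ioo (2 * δ) (1 - 2 * δ) := by
        simpa using hx.2
      obtain ⟨i, hi⟩ := hx2
      -- moving the coordinate `x i` to the nearest end point leaves the cube
      have hexit : ∃ a : ℝ, |a| < ρ ∧ x + EuclideanSpace.single i a ∉ unitCube n := by
        by_cases hi2 : 2 * δ < x i
        · refine ⟨1 - x i, ?_, fun h => ?_⟩
          · have h3 : 1 - 2 * δ ≤ x i := by
              by_contra! h4; exact hi ⟨hi2, h4⟩
            rw [abs_of_pos (sub_pos.2 (hx.1 i).2)]
            linarith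
          · have := (h i).2
            simp at this
        · refine ⟨-x i, ?_, fun h => ?_⟩
          · rw [abs_neg, abs_of_pos (hx.1 i).1]
            linarith
          · have := (h i).1
            simp at this
      obtain ⟨a, ha, hxa⟩ := hexit
      have hd := hρu (a := x) (b := x + EuclideanSpace.single i a) (by simpa using ha)
      rw [hu0 _ hxa, dist_zero_right] at hd
      exact hd.le
    rw [dist_zero_right, ← setIntegral_eq_integral_of_forall_compl_eq_zero hoff]
    have hfin : volume S < ⊤ :=
      (measure_mono sdiff_subset).trans_lt (by simp [volume_unitCube])
    calc ‖∫ x in S, (φ x * fderiv ℝ (η k) x v) • u x‖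
        ≤ (B * (C / δ * ‖v‖) * (ε / (D + 1))) * volume.real S := by
          refine norm_setIntegral_le_of_norm_le_const hfin fun x hx => ?_
          rw [norm_smul, norm_mul]
          gcongr
          · exact hB x
          · exact ((fderiv ℝ (η k) x).le_opNorm v).trans (by gcongr; exact hηd k x)
          · exact hsmall x hx
      _ ≤ (B * (C / δ * ‖v‖) * (ε / (D + 1))) * (4 * n * δ) := by
          gcongr
          exact volume_boundary_layer_le n hδ0 hδ4
      _ = ε * (D / (D + 1)) := by
          rw [hD]; field_simp
      _ < ε := by
          refine mul_lt_of_lt_one_right hε ((div_lt_one (by positivity)).2 (by linarith))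
  have t4 := (t2.neg.sub t3).congr fun k => (hid k).symm
  rw [sub_zero] at t4
  exact tendsto_nhds_unique t1 t4

/-! ### Lower semicontinuity of the energy -/

/-- Jensen's inequality for the power `p` and the probability density `w`. -/
theorem rpow_lintegral_mul_le {α : Type*} [MeasurableSpace α] {μ : Measure α} {p : ℝ} (hp : 1 ≤ p)
    {w f : α → ENNReal} (hw : AEMeasurable w μ) (hf : AEMeasurable f μ) (hw1 : ∫⁻ x, w x ∂μ = 1) :
    (∫⁻ x, w x * f x ∂μ) ^ p ≤ ∫⁻ x, w x * f x ^ p ∂μ := by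
  have hp0 : 0 < p := one_pos.trans_le hp
  have h := ENNReal.lintegral_mul_norm_pow_le (μ := μ) (f := fun x => w x * f x ^ p) (g := w)
    (hw.mul (hf.pow_const p)) hw (p := 1 / p) (q := 1 - 1 / p) (by positivity)
    (sub_nonneg.2 ((div_le_one hp0).2 hp)) (by ring)
  rw [hw1, ENNReal.one_rpow, mul_one] at h
  have e : ∀ x, (w x * f x ^ p) ^ (1 / p) * w x ^ (1 - 1 / p) = w x * f x := fun x => by
    rw [ENNReal.mul_rpow_of_nonneg _ _ (by positivity), ← ENNReal.rpow_mul, mul_one_div_cancel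
      hp0.ne', ENNReal.rpow_one, mul_right_comm, ← ENNReal.rpow_add_of_nonneg _ _ (by positivity)
      (sub_nonneg.2 ((div_le_one hp0).2 hp))]
    simp
  simp only [e] at h
  calc _ ≤ ((∫⁻ x, w x * f x ^ p ∂μ) ^ (1 / p)) ^ p := by gcongr
    _ = _ := by rw [← ENNReal.rpow_mul, one_div_mul_cancel hp0.ne', ENNReal.rpow_one]

section Mollification

theorem integrable_indicator_of_integrableOn {α W : Type*} [MeasurableSpace α] {μ : Measure α}
    [NormedAddCommGroup W] {U : Set α} (hU : MeasurableSet U) {G : α → W}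
    (hG : IntegrableOn G U μ) : Integrable (U.indicator G) μ :=
  hG.integrable_indicator hU

variable {n : ℕ} {F : Type*} [NormedAddCommGroup F] [NormedSpace ℝ F]

/-- The mollification of a function by a kernel. -/
noncomputable def mollify {W : Type*} [NormedAddCommGroup W] [NormedSpace ℝ W] (ρ : Euc n → ℝ)
    (f : Euc n → W) (x : Euc n) : W := ∫ y, ρ (x - y) • f y

theorem mollify_eq_convolution {W : Type*} [NormedAddCommGroup W] [NormedSpace ℝ W] (ρ : Euc n → ℝ)
    (f : Euc n → W) : mollify ρ f = convolution ρ f (ContinuousLinearMap.lsmul ℝ ℝ) volume := by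
  ext1 x
  rw [convolution_lsmul_swap]; rfl

theorem tsupport_comp_sub_subset (φ : ContDiffBump (0 : Euc n)) (x : Euc n) :
    tsupport (fun y => φ.normed volume (x - y)) ⊆ Metric.closedBall x φ.rOut := by
  refine closure_minimal (fun y hy => ?_) Metric.isClosed_closedBall
  have : x - y ∈ Function.support (φ.normed volume) := hy
  rw [φ.support_normed_eq, mem_ball_zero_iff] at this
  rw [Metric.mem_closedBall, dist_comm, dist_eq_norm]
  exact this.le

theorem contDiff_comp_sub (φ : ContDiffBump (0 : Euc n)) (x : Euc n) :
    ContDiff ℝ ∞ fun y => φ.normed volume (x - y) :=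
  φ.contDiff_normed.comp (contDiff_const.sub contDiff_id)

theorem hasCompactSupport_comp_sub (φ : ContDiffBump (0 : Euc n)) (x : Euc n) :
    HasCompactSupport fun y => φ.normed volume (x - y) :=
  (isCompact_closedBall x φ.rOut).of_isClosed_subset (isClosed_tsupport _)
    (tsupport_comp_sub_subset φ x)

theorem integral_norm_fderiv_comp_sub (φ : ContDiffBump (0 : Euc n)) (x : Euc n) :
    ∫ y, ‖fderiv ℝ (fun y => φ.normed volume (x - y)) y‖ =
      ∫ y, ‖fderiv ℝ (φ.normed volume) y‖ := by
  rw [← integral_sub_left_eq_self (fun y => ‖fderiv ℝ (φ.normed volume) y‖) volume x]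
  congr 1
  ext1 y
  have hd : DifferentiableAt ℝ (φ.normed volume) (x - y) :=
    (φ.contDiff_normed (n := 1)).differentiable (by simp) _
  have := hd.hasFDerivAt.comp y ((hasFDerivAt_id y).const_sub x)
  have e : fderiv ℝ (fun y => φ.normed volume (x - y)) y = -fderiv ℝ (φ.normed volume) (x - y) := by
    refine (this.congr_of_eventuallyEq (Eventually.of_forall fun _ => rfl)).fderiv.trans ?_
    ext v; simp
  rw [e, norm_neg]

/-- Mollification by a probability kernel does not increase the energy. -/
theorem lintegral_enorm_mollify_rpow_le [CompleteSpace F] {W : Type*} [NormedAddCommGroup W]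
    [NormedSpace ℝ W] [CompleteSpace W] (L : W →L[ℝ] F) {p : ℝ} (hp : 1 ≤ p)
    (φ : ContDiffBump (0 : Euc n)) {H : Euc n → W} (hH : Integrable H) :
    ∫⁻ x, ‖L (mollify (φ.normed volume) H x)‖ₑ ^ p ≤ ∫⁻ x, ‖L (H x)‖ₑ ^ p := by
  set ρ : Euc n → ℝ := φ.normed volume with hρ
  have hρc : Continuous ρ := φ.continuous_normed
  have hρ1 : ∫⁻ y, ENNReal.ofReal (ρ y) = 1 := by
    rw [← ofReal_integral_eq_lintegral_ofReal φ.integrable_normed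
      (Eventually.of_forall fun y => φ.nonneg_normed y), φ.integral_normed, ENNReal.ofReal_one]
  have hLH : AEMeasurable (fun y => ‖L (H y)‖ₑ) volume :=
    (L.integrable_comp hH).1.enorm
  have h1 : ∀ x, ‖L (mollify ρ H x)‖ₑ ^ p ≤
      ∫⁻ y, ENNReal.ofReal (ρ (x - y)) * ‖L (H y)‖ₑ ^ p := by
    intro x
    have hi : Integrable fun y => ρ (x - y) • H y :=
      integrable_smul_of_tsupport_subset (hH.locallyIntegrable.locallyIntegrableOn univ)
        (contDiff_comp_sub φ x).continuous (hasCompactSupport_comp_sub φ x) (subset_univ _)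
    have h2 : ‖L (mollify ρ H x)‖ₑ ≤ ∫⁻ y, ENNReal.ofReal (ρ (x - y)) * ‖L (H y)‖ₑ := by
      rw [mollify, ← L.integral_comp_comm hi]
      refine (enorm_integral_le_lintegral_enorm _).trans_eq (lintegral_congr fun y => ?_)
      rw [L.map_smul, enorm_smul, Real.enorm_of_nonneg (φ.nonneg_normed _)]
    calc _ ≤ (∫⁻ y, ENNReal.ofReal (ρ (x - y)) * ‖L (H y)‖ₑ) ^ p := by gcongr
      _ ≤ _ := by
        refine rpow_lintegral_mul_le hp ?_ hLH ?_
        · exact (ENNReal.measurable_ofReal.comp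
            (hρc.comp (continuous_const.sub continuous_id)).measurable).aemeasurable
        · rw [lintegral_sub_left_eq_self (fun y => ENNReal.ofReal (ρ y)) x, hρ1]
  calc _ ≤ ∫⁻ x, ∫⁻ y, ENNReal.ofReal (ρ (x - y)) * ‖L (H y)‖ₑ ^ p := lintegral_mono h1
    _ = ∫⁻ y, ∫⁻ x, ENNReal.ofReal (ρ (x - y)) * ‖L (H y)‖ₑ ^ p := by
      refine lintegral_lintegral_swap ?_
      refine AEMeasurable.mul ?_ ?_
      · exact (ENNReal.measurable_ofReal.comp
          (hρc.comp (continuous_fst.sub continuous_snd)).measurable).aemeasurable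
      · exact (hLH.pow_const p).comp_snd
    _ = _ := by
      refine lintegral_congr fun y => ?_
      have hm : Measurable fun x => ENNReal.ofReal (ρ (x - y)) := by fun_prop
      rw [lintegral_mul_const _ hm,
        lintegral_sub_right_eq_self (fun x => ENNReal.ofReal (ρ x)) y, hρ1, one_mul]

theorem continuous_mollify {W : Type*} [NormedAddCommGroup W] [NormedSpace ℝ W]
    (φ : ContDiffBump (0 : Euc n)) {H : Euc n → W} (hH : Integrable H) :
    Continuous (mollify (φ.normed volume) H) := by
  rw [mollify_eq_convolution]
  exact φ.hasCompactSupport_normed.continuous_convolution_left _ φ.continuous_normed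
    hH.locallyIntegrable

theorem tendsto_lintegral_of_lt {α : Type*} [MeasurableSpace α] {μ : Measure α}
    {f : ℕ → α → ENNReal} {f' : α → ENNReal} (hf : ∀ k, AEMeasurable (f k) μ)
    (hlim : ∀ᵐ x ∂μ, Tendsto (fun k => f k x) atTop (𝓝 (f' x))) {c : ENNReal}
    (hc : c < ∫⁻ x, f' x ∂μ) : ∃ k, c < ∫⁻ x, f k x ∂μ := by
  have h1 : ∫⁻ x, f' x ∂μ ≤ liminf (fun k => ∫⁻ x, f k x ∂μ) atTop := by
    refine (lintegral_mono_ae ?_).trans (lintegral_liminf_le' hf)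
    filter_upwards [hlim] with x hx
    exact hx.liminf_eq.ge
  exact (eventually_lt_of_lt_liminf (hc.trans_le h1)).exists

/-- A mollification scale at which the energy, restricted to the points where the mollification
only sees values in `U`, exceeds any given number below the energy. -/
theorem exists_lt_lintegral_mollify {V : Type*} [NormedAddCommGroup V] [NormedSpace ℝ V]
    [CompleteSpace V] (L : V →L[ℝ] F) (p : ℝ) {U : Set (Euc n)} (hU : IsOpen U)
    {G : Euc n → V} (hG : IntegrableOn G U)
    {c : ENNReal} (hc : c < ∫⁻ x in U, ‖L (G x)‖ₑ ^ p) :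
    ∃ (φ : ContDiffBump (0 : Euc n)) (W : Set (Euc n)), MeasurableSet W ∧
      (∀ x ∈ W, Metric.closedBall x φ.rOut ⊆ U) ∧
      c < ∫⁻ x in U, W.indicator
        (fun x => ‖L (mollify (φ.normed volume) (U.indicator G) x)‖ₑ ^ p) x := by
  set Gi := U.indicator G with hGi
  have hGii : Integrable Gi :=
    integrable_indicator_of_integrableOn hU.measurableSet hG
  let φ : ℕ → ContDiffBump (0 : Euc n) := fun k =>
    ⟨1 / (k + 1), 2 / (k + 1), by positivity, by gcongr; norm_num⟩
  have hφ : Tendsto (fun k => (φ k).rOut) atTop (𝓝 0) := by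
    have := (tendsto_one_div_add_atTop_nhds_zero_nat (𝕜 := ℝ)).const_mul 2
    rw [mul_zero] at this
    refine this.congr fun k => ?_
    change 2 * (1 / ((k : ℝ) + 1)) = 2 / (k + 1)
    ring
  have hφ2 : ∀ᶠ k in atTop, (φ k).rOut ≤ 2 * (φ k).rIn := Eventually.of_forall fun k => by
    change 2 / ((k : ℝ) + 1) ≤ 2 * (1 / (k + 1))
    apply le_of_eq; ring
  have hae := ContDiffBump.ae_convolution_tendsto_right_of_locallyIntegrable (μ := volume) hφ hφ2
    hGii.locallyIntegrable
  clear_value φ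
  have hWm : ∀ k, MeasurableSet (Metric.cthickening (φ k).rOut Uᶜ)ᶜ := fun k =>
    Metric.isClosed_cthickening.measurableSet.compl
  have hWlim : ∀ x ∈ U, ∀ᶠ k in atTop, x ∈ (Metric.cthickening (φ k).rOut Uᶜ)ᶜ := by
    intro x hx
    have h1 : 0 < Metric.infEDist x Uᶜ := by
      rw [Metric.infEDist_pos_iff_notMem_closure, hU.isClosed_compl.closure_eq]
      exact fun h => h hx
    have h2 : Tendsto (fun k => ENNReal.ofReal (φ k).rOut) atTop (𝓝 0) := by
      simpa using ENNReal.tendsto_ofReal hφ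
    filter_upwards [h2.eventually_lt_const h1] with k hk
    rw [mem_compl_iff, Metric.mem_cthickening_iff, not_le]
    exact hk
  obtain ⟨k, hk⟩ : ∃ k, c < ∫⁻ x in U, ((Metric.cthickening (φ k).rOut Uᶜ)ᶜ).indicator
      (fun x => ‖L (mollify ((φ k).normed volume) Gi x)‖ₑ ^ p) x := by
    refine tendsto_lintegral_of_lt (fun k => ?_) ?_ hc
    · refine Measurable.aemeasurable (Measurable.indicator ?_ (hWm k))
      exact ((L.continuous.comp (continuous_mollify (φ k) hGii)).enorm.measurable).pow_const p
    · rw [ae_restrict_iff' hU.measurableSet]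
      filter_upwards [hae] with x hx hxU
      have h3 : Tendsto (fun k => ‖L (mollify ((φ k).normed volume) Gi x)‖ₑ ^ p) atTop
          (𝓝 (‖L (G x)‖ₑ ^ p)) := by
        have e : Gi x = G x := indicator_of_mem hxU G
        rw [← e]
        simp only [mollify_eq_convolution]
        exact (((ENNReal.continuous_rpow_const.comp continuous_enorm).comp
          L.continuous).tendsto (Gi x)).comp hx
      refine h3.congr' ?_
      filter_upwards [hWlim x hxU] with k hk
      rw [indicator_of_mem hk]
  refine ⟨φ k, _, hWm k, fun x hx y hy => ?_, hk⟩
  by_contra hyU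
  exact hx (Metric.mem_cthickening_of_dist_le x y _ _ hyU (by rwa [dist_comm]))

/-- Mollification turns uniform closeness of maps into closeness of the derivatives. -/
theorem HasWeakDerivOn.norm_mollify_sub_le {U : Set (Euc n)} {g h : Euc n → Euc n}
    {G H : Euc n → (Euc n →L[ℝ] Euc n)} (hh : HasWeakDerivOn U h H) (hg : HasWeakDerivOn U g G)
    (φ : ContDiffBump (0 : Euc n)) {x : Euc n} (hx : Metric.closedBall x φ.rOut ⊆ U) {ε : ℝ}
    (hε : ∀ x ∈ U, ‖h x - g x‖ ≤ ε) :
    ‖mollify (φ.normed volume) (U.indicator H) x - mollify (φ.normed volume) (U.indicator G) x‖ ≤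
      ε * ∫ y, ‖fderiv ℝ (φ.normed volume) y‖ := by
  have hsU := (tsupport_comp_sub_subset φ x).trans hx
  have hcd := contDiff_comp_sub φ x
  have hcc := hasCompactSupport_comp_sub φ x
  have hmol : ∀ V : Euc n → (Euc n →L[ℝ] Euc n),
      mollify (φ.normed volume) (U.indicator V) x = ∫ y, φ.normed volume (x - y) • V y := by
    intro V
    refine integral_congr_ae (Eventually.of_forall fun y => ?_)
    by_cases hy : y ∈ U
    · simp only [indicator_of_mem hy]
    · have : φ.normed volume (x - y) = 0 :=
        image_eq_zero_of_notMem_tsupport (f := fun y => φ.normed volume (x - y))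
          fun h => hy (hsU h)
      ext1 v
      simp only [this, smul_apply, zero_smul]
  have h6 := hh.norm_integral_smul_sub_le hg hcd hcc hsU hε
  rw [integral_norm_fderiv_comp_sub φ x] at h6
  simp only [smul_sub] at h6
  rwa [integral_sub (hh.integrable_smul hcd hcc hsU) (hg.integrable_smul hcd hcc hsU),
    ← hmol H, ← hmol G] at h6

/-- Lower semicontinuity of `∫_U ‖L Dg‖ ^ p` under uniform convergence of `g`: mollification at a
fixed scale turns uniform convergence of maps into uniform convergence of the derivatives, and it
does not increase the energy. -/
theorem exists_lt_lintegral_of_uniformly_close [CompleteSpace F]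
    (L : (Euc n →L[ℝ] Euc n) →L[ℝ] F) {p : ℝ}
    (hp : 1 ≤ p) {U : Set (Euc n)} (hU : IsOpen U) {g : Euc n → Euc n}
    {G : Euc n → (Euc n →L[ℝ] Euc n)} (hg : HasWeakDerivOn U g G) (hG : IntegrableOn G U)
    {c : ENNReal} (hc : c < ∫⁻ x in U, ‖L (G x)‖ₑ ^ p) :
    ∃ ε > 0, ∀ (h : Euc n → Euc n) (H : Euc n → (Euc n →L[ℝ] Euc n)), HasWeakDerivOn U h H →
      IntegrableOn H U → (∀ x ∈ U, ‖h x - g x‖ ≤ ε) → c < ∫⁻ x in U, ‖L (H x)‖ₑ ^ p := by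
  have hp0 : 0 < p := one_pos.trans_le hp
  obtain ⟨φ, W, hWm, hWU, hk⟩ := exists_lt_lintegral_mollify L p hU hG hc
  have hGii : Integrable (U.indicator G) :=
    integrable_indicator_of_integrableOn hU.measurableSet hG
  -- choice of the admissible error in the mollified derivatives
  obtain ⟨j, hj⟩ : ∃ j : ℕ, c < ∫⁻ x in U, W.indicator
      (fun x => (‖L (mollify (φ.normed volume) (U.indicator G) x)‖ₑ -
        ENNReal.ofReal (1 / (j + 1))) ^ p) x := by
    refine tendsto_lintegral_of_lt (fun j => ?_) (Eventually.of_forall fun x => ?_) hk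
    · refine Measurable.aemeasurable (Measurable.indicator ?_ hWm)
      exact (((L.continuous.comp (continuous_mollify φ hGii)).enorm.measurable).sub_const
        _).pow_const p
    · by_cases hx : x ∈ W
      · simp only [indicator_of_mem hx]
        have h4 : Tendsto (fun j : ℕ => ENNReal.ofReal (1 / ((j : ℝ) + 1))) atTop (𝓝 0) := by
          simpa using ENNReal.tendsto_ofReal (tendsto_one_div_add_atTop_nhds_zero_nat (𝕜 := ℝ))
        have h5 := ENNReal.Tendsto.sub
          (tendsto_const_nhds (x := ‖L (mollify (φ.normed volume) (U.indicator G) x)‖ₑ)) h4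
          (Or.inl enorm_ne_top)
        rw [tsub_zero] at h5
        exact (ENNReal.continuous_rpow_const.tendsto _).comp h5
      · simp only [indicator_of_notMem hx]
        exact tendsto_const_nhds
  set a : ℝ := 1 / ((j : ℝ) + 1) with ha
  have ha0 : 0 < a := by positivity
  set D : ℝ := ∫ y, ‖fderiv ℝ (φ.normed volume) y‖ with hD
  have hD0 : 0 ≤ D := integral_nonneg fun _ => norm_nonneg _
  refine ⟨a / (‖L‖ * D + 1), by positivity, fun h H hh hH hclose => ?_⟩
  have hHii : Integrable (U.indicator H) :=
    integrable_indicator_of_integrableOn hU.measurableSet hH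
  have hdiff : ∀ x ∈ W, ‖L (mollify (φ.normed volume) (U.indicator G) x)‖ₑ - ENNReal.ofReal a ≤
      ‖L (mollify (φ.normed volume) (U.indicator H) x)‖ₑ := by
    intro x hx
    have h6 := hh.norm_mollify_sub_le hg φ (hWU x hx) hclose
    generalize mollify (φ.normed volume) (U.indicator H) x = A at h6 ⊢
    generalize mollify (φ.normed volume) (U.indicator G) x = B at h6 ⊢
    have h7 : ‖L B‖ ≤ ‖L A‖ + a := by
      have h8 : ‖L A - L B‖ ≤ a := by
        rw [← map_sub]
        calc _ ≤ ‖L‖ * (a / (‖L‖ * D + 1) * D) := (L.le_opNorm _).trans (by gcongr)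
          _ = a * (‖L‖ * D / (‖L‖ * D + 1)) := by ring
          _ ≤ a * 1 := by
            gcongr
            exact (div_le_one (by positivity)).2 (by linarith)
          _ = a := mul_one a
      have := norm_sub_norm_le (L B) (L A)
      rw [norm_sub_rev] at this
      linarith
    rw [tsub_le_iff_right, ← ofReal_norm, ← ofReal_norm,
      ← ENNReal.ofReal_add (norm_nonneg _) ha0.le]
    exact ENNReal.ofReal_le_ofReal h7
  calc c < _ := hj
    _ ≤ ∫⁻ x in U, ‖L (mollify (φ.normed volume) (U.indicator H) x)‖ₑ ^ p := by
      refine lintegral_mono fun x => ?_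
      by_cases hx : x ∈ W
      · rw [indicator_of_mem hx]
        exact ENNReal.rpow_le_rpow (hdiff x hx) hp0.le
      · rw [indicator_of_notMem hx]
        exact zero_le
    _ ≤ ∫⁻ x, ‖L (mollify (φ.normed volume) (U.indicator H) x)‖ₑ ^ p :=
      setLIntegral_le_lintegral _ _
    _ ≤ ∫⁻ x, ‖L (U.indicator H x)‖ₑ ^ p := lintegral_enorm_mollify_rpow_le L hp φ hHii
    _ = ∫⁻ x, U.indicator (fun x => ‖L (H x)‖ₑ ^ p) x := by
      refine lintegral_congr fun x => ?_
      by_cases hx : x ∈ U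
      · simp only [indicator_of_mem hx]
      · simp only [indicator_of_notMem hx, map_zero, enorm_zero, ENNReal.zero_rpow_of_pos hp0]
    _ = _ := lintegral_indicator hU.measurableSet _

end Mollification

/-! ### The energy gap of singular matrices -/

/-- The trace of a linear map, in coordinates. -/
noncomputable def coordTrace {n : ℕ} (A : Euc n →L[ℝ] Euc n) : ℝ :=
  ∑ i, A (EuclideanSpace.single i 1) i

theorem coordTrace_id (n : ℕ) : coordTrace (ContinuousLinearMap.id ℝ (Euc n)) = n := by
  simp [coordTrace]

theorem apply_eq_sum_entries {n : ℕ} (A : Euc n →L[ℝ] Euc n) (v : Euc n) (i : Fin n) :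
    A v i = ∑ j, A (EuclideanSpace.single j 1) i * v j := by
  have h : v = ∑ j, v j • EuclideanSpace.single j (1 : ℝ) := by
    ext k; simp [Finset.sum_apply, Pi.single_apply]
  conv_lhs => rw [h]
  simp [mul_comm]

theorem frobeniusNorm_sq {n : ℕ} (A : Euc n →L[ℝ] Euc n) :
    frobeniusNorm n A ^ 2 = ∑ i, ∑ j, (A (EuclideanSpace.single j 1) i) ^ 2 :=
  Real.sq_sqrt (Finset.sum_nonneg fun _ _ => Finset.sum_nonneg fun _ _ => sq_nonneg _)

theorem frobeniusNorm_nonneg {n : ℕ} (A : Euc n →L[ℝ] Euc n) : 0 ≤ frobeniusNorm n A :=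
  Real.sqrt_nonneg _

theorem norm_le_frobeniusNorm {n : ℕ} (A : Euc n →L[ℝ] Euc n) : ‖A‖ ≤ frobeniusNorm n A := by
  refine A.opNorm_le_bound (frobeniusNorm_nonneg A) fun v => ?_
  refine abs_le_of_sq_le_sq' ?_ (mul_nonneg (frobeniusNorm_nonneg A) (norm_nonneg _)) |>.2
  rw [mul_pow, frobeniusNorm_sq, EuclideanSpace.real_norm_sq_eq, EuclideanSpace.real_norm_sq_eq,
    Finset.sum_mul]
  refine Finset.sum_le_sum fun i _ => ?_
  rw [apply_eq_sum_entries]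
  exact Finset.sum_mul_sq_le_sq_mul_sq _ _ _

theorem frobeniusNorm_le {n : ℕ} (A : Euc n →L[ℝ] Euc n) :
    frobeniusNorm n A ≤ Real.sqrt n * ‖A‖ := by
  refine abs_le_of_sq_le_sq' ?_ (by positivity) |>.2
  rw [mul_pow, frobeniusNorm_sq, Real.sq_sqrt (Nat.cast_nonneg n), Finset.sum_comm]
  calc _ ≤ ∑ _j : Fin n, ‖A‖ ^ 2 := by
        refine Finset.sum_le_sum fun j _ => ?_
        rw [← EuclideanSpace.real_norm_sq_eq]
        gcongr
        simpa using A.le_opNorm (EuclideanSpace.single j 1)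
    _ = _ := by simp

/-- For a singular matrix `A`, with unit vector `w` in its kernel, the trace of `A` is the inner
product of `A` with the projection to the complement of `w`, whose Frobenius norm is only
`√(n - 1)`. -/
theorem coordTrace_le_of_det_eq_zero {n : ℕ} {A : Euc n →L[ℝ] Euc n} (hA : A.det = 0) :
    coordTrace A ≤ Real.sqrt (n - 1) * frobeniusNorm n A := by
  obtain ⟨v, hv, hv0⟩ : ∃ v : Euc n, A v = 0 ∧ v ≠ 0 := by
    have h := LinearMap.bot_lt_ker_of_det_eq_zero (f := (A : Euc n →ₗ[ℝ] Euc n)) hA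
    obtain ⟨v, hv, hv0⟩ := (Submodule.ne_bot_iff _).1 h.ne'
    exact ⟨v, by simpa using hv, hv0⟩
  set w : Euc n := ‖v‖⁻¹ • v with hw
  have hAw : A w = 0 := by rw [hw, map_smul, hv, smul_zero]
  have hw1 : ∑ i, w i ^ 2 = 1 := by
    rw [← EuclideanSpace.real_norm_sq_eq, hw, norm_smul, norm_inv, norm_norm,
      inv_mul_cancel₀ (norm_ne_zero_iff.2 hv0), one_pow]
  have hn : (0 : ℝ) ≤ n - 1 := by
    have : n ≠ 0 := by
      rintro rfl
      exact hv0 (Subsingleton.elim _ _)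
    have : (1 : ℝ) ≤ n := by exact_mod_cast Nat.one_le_iff_ne_zero.2 this
    linarith
  set P : Fin n → Fin n → ℝ := fun i j => (if i = j then 1 else 0) - w i * w j with hP
  have htr : coordTrace A =
      ∑ x : Fin n × Fin n, A (EuclideanSpace.single x.2 1) x.1 * P x.1 x.2 := by
    rw [Fintype.sum_prod_type]
    have h0 : ∀ i, ∑ j, A (EuclideanSpace.single j 1) i * w j = 0 := fun i => by
      rw [← apply_eq_sum_entries, hAw]; rfl
    have h1 : ∀ i, ∑ j, A (EuclideanSpace.single j 1) i * P i j =
        A (EuclideanSpace.single i 1) i := fun i => by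
      simp only [hP, mul_sub, Finset.sum_sub_distrib]
      have h2 : ∑ j, A (EuclideanSpace.single j 1) i * (w i * w j) = 0 := by
        calc _ = w i * ∑ j, A (EuclideanSpace.single j 1) i * w j := by
              rw [Finset.mul_sum]
              exact Finset.sum_congr rfl fun j _ => by ring
          _ = 0 := by rw [h0, mul_zero]
      rw [h2]
      simp
    simp only [h1, coordTrace]
  have hPs : ∑ x : Fin n × Fin n, P x.1 x.2 ^ 2 = n - 1 := by
    rw [Fintype.sum_prod_type]
    have h1 : ∀ i, ∑ j, P i j ^ 2 = 1 - w i ^ 2 := fun i => by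
      have h2 : ∀ j, P i j ^ 2 = (if i = j then 1 - 2 * (w i * w j) else 0) +
          w i ^ 2 * w j ^ 2 := fun j => by
        simp only [hP]
        split_ifs <;> ring
      simp only [h2, Finset.sum_add_distrib, Finset.sum_ite_eq, Finset.mem_univ, if_true,
        ← Finset.mul_sum, hw1]
      ring
    simp only [h1, Finset.sum_sub_distrib, hw1]
    simp
  refine abs_le_of_sq_le_sq' ?_ (mul_nonneg (Real.sqrt_nonneg _) (frobeniusNorm_nonneg A)) |>.2
  rw [mul_pow, Real.sq_sqrt hn, frobeniusNorm_sq, htr, mul_comm, ← hPs, ← Fintype.sum_prod_type']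
  exact Finset.sum_mul_sq_le_sq_mul_sq _ _ _

/-- An improvement by the factor `1 - θ` of the bound of the trace by the norm gives a uniform gap
above the tangent plane at the identity of the energy density, by Young's inequality. -/
theorem exists_energy_gap {n : ℕ} (hn : 0 < n) {F : Type*} [NormedAddCommGroup F] [NormedSpace ℝ F]
    (L : (Euc n →L[ℝ] Euc n) →L[ℝ] F) {p θ : ℝ} (hp : 1 < p) (hθ0 : 0 ≤ θ) (hθ1 : θ < 1)
    (hI : 0 < ‖L (ContinuousLinearMap.id ℝ (Euc n))‖)
    (hL : ∀ A : Euc n →L[ℝ] Euc n, A.det = 0 →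
      coordTrace A * ‖L (ContinuousLinearMap.id ℝ (Euc n))‖ ≤ θ * n * ‖L A‖) :
    ∃ c > 0, ∃ κ, ∀ A : Euc n →L[ℝ] Euc n, A.det = 0 →
      ‖L (ContinuousLinearMap.id ℝ (Euc n))‖ ^ p * (1 + c) + κ * (coordTrace A - n) ≤
        ‖L A‖ ^ p := by
  have hpq := Real.HolderConjugate.conjExponent hp
  set q := p.conjExponent with hq
  set b := ‖L (ContinuousLinearMap.id ℝ (Euc n))‖ with hb
  have hn' : (0 : ℝ) < n := Nat.cast_pos.2 hn
  refine ⟨(p - 1) * (1 - θ ^ q), mul_pos (by linarith)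
    (sub_pos.2 (Real.rpow_lt_one hθ0 hθ1 hpq.symm.pos)), b ^ p * (p / n), fun A hA => ?_⟩
  set a := ‖L A‖ / b with ha
  have ha0 : 0 ≤ a := by positivity
  have hLA : ‖L A‖ = a * b := by rw [ha]; field_simp
  have ht : coordTrace A / n ≤ θ * a := by
    rw [div_le_iff₀ hn']
    have := hL A hA
    rw [hLA] at this
    refine le_of_mul_le_mul_right ?_ hI
    linarith
  have hy := Real.young_inequality_of_nonneg ha0 hθ0 hpq
  have hqp : p / q = p - 1 := by
    rw [hq, Real.conjExponent]
    have : p - 1 ≠ 0 := by linarith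
    field_simp
  have hy' : p * (θ * a) ≤ a ^ p + (p - 1) * θ ^ q := by
    have h1 := mul_le_mul_of_nonneg_left hy (by linarith : (0 : ℝ) ≤ p)
    have h2 : p * (a ^ p / p + θ ^ q / q) = a ^ p + p / q * θ ^ q := by
      field_simp
    rw [h2, hqp] at h1
    linarith
  rw [hLA, Real.mul_rpow ha0 hI.le]
  have h3 : p * (coordTrace A / n) ≤ p * (θ * a) := by gcongr
  have h4 : 1 + (p - 1) * (1 - θ ^ q) + p * (coordTrace A / n - 1) ≤ a ^ p := by linarith
  have h5 : p / n * (coordTrace A - n) = p * (coordTrace A / n - 1) := by field_simp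
  calc _ = b ^ p * (1 + (p - 1) * (1 - θ ^ q) + p / n * (coordTrace A - n)) := by ring
    _ ≤ b ^ p * a ^ p := by rw [h5]; gcongr
    _ = _ := mul_comm _ _

/-- The matrix entries of a linear map, as a vector of the Euclidean space of dimension `n²`. -/
noncomputable def entries (n : ℕ) :
    (Euc n →L[ℝ] Euc n) →L[ℝ] EuclideanSpace ℝ (Fin n × Fin n) :=
  LinearMap.toContinuousLinearMap
    { toFun := fun A => WithLp.toLp 2 fun x => A (EuclideanSpace.single x.2 1) x.1
      map_add' := fun A B => by ext x; simp
      map_smul' := fun r A => by ext x; simp }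

theorem norm_entries {n : ℕ} (A : Euc n →L[ℝ] Euc n) : ‖entries n A‖ = frobeniusNorm n A := by
  rw [EuclideanSpace.norm_eq, frobeniusNorm, Fintype.sum_prod_type]
  simp [entries]

theorem frobeniusNorm_id (n : ℕ) :
    frobeniusNorm n (ContinuousLinearMap.id ℝ (Euc n)) = Real.sqrt n := by
  rw [frobeniusNorm]
  congr 1
  simp

theorem exists_energy_gap_frobenius {n : ℕ} (hn : 0 < n) {p : ℝ} (hp : 1 < p) :
    ∃ c > 0, ∃ κ, ∀ A : Euc n →L[ℝ] Euc n, A.det = 0 →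
      ‖entries n (ContinuousLinearMap.id ℝ (Euc n))‖ ^ p * (1 + c) + κ * (coordTrace A - n) ≤
        ‖entries n A‖ ^ p := by
  have hn' : (0 : ℝ) < n := Nat.cast_pos.2 hn
  refine exists_energy_gap hn (entries n) (θ := Real.sqrt (n - 1) / Real.sqrt n) hp (by positivity)
    ?_ ?_ fun A hA => ?_
  · rw [div_lt_one (Real.sqrt_pos.2 hn')]
    exact Real.sqrt_lt_sqrt_iff_of_pos hn' |>.2 (by linarith)
  · rw [norm_entries, frobeniusNorm_id]; positivity
  · rw [norm_entries, norm_entries, frobeniusNorm_id]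
    calc _ ≤ (Real.sqrt (n - 1) * frobeniusNorm n A) * Real.sqrt n := by
          gcongr
          exact coordTrace_le_of_det_eq_zero hA
      _ = _ := by
        have h := Real.mul_self_sqrt hn'.le
        field_simp
        rw [sq, h]
        ring

theorem exists_energy_gap_operator {n : ℕ} (hn : 0 < n) {p : ℝ} (hp : 1 < p) :
    ∃ c > 0, ∃ κ, ∀ A : Euc n →L[ℝ] Euc n, A.det = 0 →
      ‖ContinuousLinearMap.id ℝ (Euc n →L[ℝ] Euc n) (ContinuousLinearMap.id ℝ (Euc n))‖ ^ p *
        (1 + c) + κ * (coordTrace A - n) ≤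
        ‖ContinuousLinearMap.id ℝ (Euc n →L[ℝ] Euc n) A‖ ^ p := by
  have hn' : (0 : ℝ) < n := Nat.cast_pos.2 hn
  have : Nonempty (Fin n) := ⟨⟨0, hn⟩⟩
  have h1 : ‖ContinuousLinearMap.id ℝ (Euc n)‖ = 1 := ContinuousLinearMap.norm_id
  refine exists_energy_gap hn _ (θ := Real.sqrt (n - 1) / Real.sqrt n) hp (by positivity)
    ?_ ?_ fun A hA => ?_
  · rw [div_lt_one (Real.sqrt_pos.2 hn')]
    exact Real.sqrt_lt_sqrt_iff_of_pos hn' |>.2 (by linarith)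
  · rw [ContinuousLinearMap.id_apply, h1]; exact one_pos
  · rw [ContinuousLinearMap.id_apply, ContinuousLinearMap.id_apply, h1, mul_one]
    calc _ ≤ Real.sqrt (n - 1) * (Real.sqrt n * ‖A‖) := by
          refine (coordTrace_le_of_det_eq_zero hA).trans ?_
          gcongr
          exact frobeniusNorm_le A
      _ = _ := by
        have h := Real.mul_self_sqrt hn'.le
        field_simp
        rw [sq, h]
        ring

/-! ### Twist maps of prescribed energy -/

section Twist

variable {n : ℕ}

/-- The rotation by the angle `θ` in the plane of the coordinates `i` and `j`. -/
noncomputable def planeRot (i j : Fin n) (θ : ℝ) (x : Euc n) : Euc n :=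
  x + ((Real.cos θ - 1) * x i - Real.sin θ * x j) • EuclideanSpace.single i 1 +
    (Real.sin θ * x i + (Real.cos θ - 1) * x j) • EuclideanSpace.single j 1

variable {i j : Fin n}

theorem planeRot_apply_left (hij : i ≠ j) (θ : ℝ) (x : Euc n) :
    planeRot i j θ x i = Real.cos θ * x i - Real.sin θ * x j := by
  simp [planeRot, hij]; ring

theorem planeRot_apply_right (hij : i ≠ j) (θ : ℝ) (x : Euc n) :
    planeRot i j θ x j = Real.sin θ * x i + Real.cos θ * x j := by
  simp [planeRot, hij.symm]; ring

theorem planeRot_apply_of_ne (θ : ℝ) (x : Euc n) {k : Fin n} (hi : k ≠ i) (hj : k ≠ j) :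
    planeRot i j θ x k = x k := by
  simp [planeRot, hi, hj]

theorem planeRot_zero (x : Euc n) : planeRot i j 0 x = x := by
  simp [planeRot]

theorem planeRot_neg_planeRot (hij : i ≠ j) (θ : ℝ) (x : Euc n) :
    planeRot i j (-θ) (planeRot i j θ x) = x := by
  have h := Real.sin_sq_add_cos_sq θ
  ext k
  by_cases hi : k = i
  · subst hi
    rw [planeRot_apply_left hij, planeRot_apply_left hij, planeRot_apply_right hij, Real.cos_neg,
      Real.sin_neg]
    linear_combination x k * h
  by_cases hj : k = j
  · subst hj
    rw [planeRot_apply_right hij, planeRot_apply_left hij, planeRot_apply_right hij, Real.cos_neg,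
      Real.sin_neg]
    linear_combination x k * h
  rw [planeRot_apply_of_ne _ _ hi hj, planeRot_apply_of_ne _ _ hi hj]

theorem norm_sq_eq_add_sum_erase (hij : i ≠ j) (x : Euc n) :
    ‖x‖ ^ 2 = x i ^ 2 + x j ^ 2 + ∑ k ∈ (Finset.univ.erase i).erase j, x k ^ 2 := by
  rw [EuclideanSpace.real_norm_sq_eq, ← Finset.add_sum_erase _ _ (Finset.mem_univ i),
    ← Finset.add_sum_erase _ _ (Finset.mem_erase.2 ⟨hij.symm, Finset.mem_univ j⟩), add_assoc]

theorem norm_planeRot (hij : i ≠ j) (θ : ℝ) (x : Euc n) : ‖planeRot i j θ x‖ = ‖x‖ := by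
  have h := Real.sin_sq_add_cos_sq θ
  have h1 : ‖planeRot i j θ x‖ ^ 2 = ‖x‖ ^ 2 := by
    rw [norm_sq_eq_add_sum_erase hij, norm_sq_eq_add_sum_erase hij x, planeRot_apply_left hij,
      planeRot_apply_right hij]
    have h2 : ∑ k ∈ (Finset.univ.erase i).erase j, planeRot i j θ x k ^ 2 =
        ∑ k ∈ (Finset.univ.erase i).erase j, x k ^ 2 :=
      Finset.sum_congr rfl fun k hk => by
        rw [Finset.mem_erase, Finset.mem_erase] at hk
        rw [planeRot_apply_of_ne _ _ hk.2.1 hk.1]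
    rw [h2]
    linear_combination (x i ^ 2 + x j ^ 2) * h
  exact (sq_eq_sq₀ (norm_nonneg _) (norm_nonneg _)).1 h1

/-- The angle profile of the twist: equal to `1` at the centre and vanishing off the unit ball, as a
function of the square of the distance. -/
noncomputable def angleProfile (s : ℝ) : ℝ := Real.smoothTransition (1 - s)

theorem contDiff_angleProfile : ContDiff ℝ ∞ angleProfile :=
  Real.smoothTransition.contDiff.comp (contDiff_const.sub contDiff_id)

/-- The map rotating the sphere of radius `ρ` about `b`, in the plane of the coordinates `i` and
`j`, by the angle `t * angleProfile (ρ² / r²)`. -/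
noncomputable def twist (i j : Fin n) (b : Euc n) (r t : ℝ) (x : Euc n) : Euc n :=
  b + planeRot i j (t * angleProfile (‖x - b‖ ^ 2 / r ^ 2)) (x - b)

theorem norm_twist_sub (hij : i ≠ j) (b : Euc n) (r t : ℝ) (x : Euc n) :
    ‖twist i j b r t x - b‖ = ‖x - b‖ := by
  rw [twist, add_sub_cancel_left, norm_planeRot hij]

theorem twist_neg_twist (hij : i ≠ j) (b : Euc n) (r t : ℝ) (x : Euc n) :
    twist i j b r (-t) (twist i j b r t x) = x := by
  conv_lhs => rw [twist]
  rw [norm_twist_sub hij, neg_mul]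
  rw [twist, add_sub_cancel_left, planeRot_neg_planeRot hij, add_sub_cancel]

theorem twist_of_notMem_ball {b : Euc n} {r : ℝ} (hr : 0 < r) (t : ℝ) {x : Euc n}
    (hx : x ∉ Metric.ball b r) : twist i j b r t x = x := by
  have h : angleProfile (‖x - b‖ ^ 2 / r ^ 2) = 0 := by
    refine Real.smoothTransition.zero_of_nonpos (sub_nonpos.2 ?_)
    rw [one_le_div (by positivity)]
    rw [Metric.mem_ball, dist_eq_norm, not_lt] at hx
    gcongr
  rw [twist, h, mul_zero, planeRot_zero, add_sub_cancel]

theorem twist_zero (b : Euc n) (r : ℝ) (x : Euc n) : twist i j b r 0 x = x := by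
  rw [twist, zero_mul, planeRot_zero, add_sub_cancel]

theorem contDiff_twist (b : Euc n) (r : ℝ) :
    ContDiff ℝ ∞ fun q : ℝ × Euc n => twist i j b r q.1 q.2 := by
  have h1 : ContDiff ℝ ∞ fun q : ℝ × Euc n => q.1 * angleProfile (‖q.2 - b‖ ^ 2 / r ^ 2) :=
    contDiff_fst.mul (contDiff_angleProfile.comp
      (((contDiff_snd.sub contDiff_const).norm_sq ℝ).div_const _))
  have hs := Real.contDiff_sin.comp h1
  have hc := Real.contDiff_cos.comp h1
  have hx : ContDiff ℝ ∞ fun q : ℝ × Euc n => q.2 - b := contDiff_snd.sub contDiff_const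
  have hk : ∀ k : Fin n, ContDiff ℝ ∞ fun q : ℝ × Euc n => (q.2 - b) k := fun k =>
    (EuclideanSpace.proj k : Euc n →L[ℝ] ℝ).contDiff.comp hx
  unfold twist planeRot
  exact contDiff_const.add ((hx.add ((((hc.sub contDiff_const).mul (hk i)).sub
    (hs.mul (hk j))).smul contDiff_const)).add (((hs.mul (hk i)).add
      ((hc.sub contDiff_const).mul (hk j))).smul contDiff_const))

theorem contDiff_twist_right (b : Euc n) (r t : ℝ) : ContDiff ℝ ∞ (twist i j b r t) :=
  ContDiff.comp (g := fun q : ℝ × Euc n => twist i j b r q.1 q.2) (f := fun x => (t, x))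
    (contDiff_twist b r) (contDiff_const.prodMk contDiff_id)

/-- The twist as a homeomorphism. -/
noncomputable def twistHomeo (hij : i ≠ j) (b : Euc n) (r t : ℝ) : Euc n ≃ₜ Euc n where
  toFun := twist i j b r t
  invFun := twist i j b r (-t)
  left_inv := twist_neg_twist hij b r t
  right_inv x := by
    have := twist_neg_twist hij b r (-t) x
    rwa [neg_neg] at this
  continuous_toFun := (contDiff_twist_right b r t).continuous
  continuous_invFun := (contDiff_twist_right b r (-t)).continuous

/-- Along a ray the twist is a spiral, whose speed bounds the derivative from below. -/
theorem mul_le_norm_fderiv_twist (hij : i ≠ j) (b : Euc n) (r t : ℝ) (y : Euc n) :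
    |t| * (|deriv angleProfile (‖y‖ ^ 2 / r ^ 2)| * (2 * ‖y‖ ^ 2 / r ^ 2) *
      Real.sqrt (y i ^ 2 + y j ^ 2)) ≤ ‖fderiv ℝ (twist i j b r t) (b + y)‖ * ‖y‖ := by
  set D := fderiv ℝ (twist i j b r t) (b + y) with hD
  set θ' := t * (deriv angleProfile (‖y‖ ^ 2 / r ^ 2) * (2 * ‖y‖ ^ 2 / r ^ 2)) with hθ'
  set θ := t * angleProfile (‖y‖ ^ 2 / r ^ 2) with hθ
  have hray : HasDerivAt (fun s : ℝ => twist i j b r t (b + s • y)) (D y) 1 := by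
    have h1 : HasDerivAt (fun s : ℝ => b + s • y) y 1 := by
      simpa using ((hasDerivAt_id (1 : ℝ)).smul_const y).const_add b
    have h2 : HasFDerivAt (twist i j b r t) D (b + (1 : ℝ) • y) := by
      rw [one_smul]
      exact ((contDiff_twist_right b r t).differentiable (by simp) _).hasFDerivAt
    exact HasFDerivAt.comp_hasDerivAt (f := fun s : ℝ => b + s • y) (l := twist i j b r t) 1 h2 h1
  have hcoord : ∀ k, HasDerivAt (fun s : ℝ => twist i j b r t (b + s • y) k) (D y k) 1 := fun k =>
    ((EuclideanSpace.proj k : Euc n →L[ℝ] ℝ).hasFDerivAt).comp_hasDerivAt 1 hray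
  have hang : HasDerivAt (fun s : ℝ => t * angleProfile (s ^ 2 * (‖y‖ ^ 2 / r ^ 2))) θ' 1 := by
    have h1 : HasDerivAt (fun s : ℝ => s ^ 2 * (‖y‖ ^ 2 / r ^ 2)) (2 * ‖y‖ ^ 2 / r ^ 2) 1 := by
      refine ((hasDerivAt_pow 2 (1 : ℝ)).mul_const (‖y‖ ^ 2 / r ^ 2)).congr_deriv ?_
      simp; ring
    have h2 : HasDerivAt angleProfile (deriv angleProfile (‖y‖ ^ 2 / r ^ 2))
        ((1 : ℝ) ^ 2 * (‖y‖ ^ 2 / r ^ 2)) := by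
      rw [one_pow, one_mul]
      exact (contDiff_angleProfile.differentiable (by simp) _).hasDerivAt
    exact (h2.comp (1 : ℝ) h1).const_mul t
  have hs := hang.sin
  have hc := hang.cos
  simp only [one_pow, one_mul, ← hθ] at hs hc
  have harg : ∀ s : ℝ, ‖b + s • y - b‖ ^ 2 / r ^ 2 = s ^ 2 * (‖y‖ ^ 2 / r ^ 2) := fun s => by
    rw [add_sub_cancel_left, norm_smul, mul_pow, Real.norm_eq_abs, sq_abs]
    ring
  have hci : D y i = (Real.cos θ * y i - Real.sin θ * y j) -
      θ' * (Real.sin θ * y i + Real.cos θ * y j) := by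
    have e : HasDerivAt (fun s : ℝ => twist i j b r t (b + s • y) i) _ 1 :=
      (((hc.mul ((hasDerivAt_id (1 : ℝ)).mul_const (y i))).sub
        (hs.mul ((hasDerivAt_id (1 : ℝ)).mul_const (y j)))).const_add (b i)).congr_of_eventuallyEq
        (Eventually.of_forall fun s => by
          simp [twist, harg, planeRot_apply_left hij, -add_sub_cancel_left])
    rw [(hcoord i).unique e]
    simp
    ring
  have hcj : D y j = (Real.sin θ * y i + Real.cos θ * y j) +
      θ' * (Real.cos θ * y i - Real.sin θ * y j) := by
    have e : HasDerivAt (fun s : ℝ => twist i j b r t (b + s • y) j) _ 1 :=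
      (((hs.mul ((hasDerivAt_id (1 : ℝ)).mul_const (y i))).add
        (hc.mul ((hasDerivAt_id (1 : ℝ)).mul_const (y j)))).const_add (b j)).congr_of_eventuallyEq
        (Eventually.of_forall fun s => by
          simp [twist, harg, planeRot_apply_right hij, -add_sub_cancel_left])
    rw [(hcoord j).unique e]
    simp
    ring
  have hsq : (|θ'| * Real.sqrt (y i ^ 2 + y j ^ 2)) ^ 2 ≤ ‖D y‖ ^ 2 := by
    have h := Real.sin_sq_add_cos_sq θ
    rw [mul_pow, sq_abs, Real.sq_sqrt (by positivity), norm_sq_eq_add_sum_erase hij (D y), hci, hcj]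
    have h0 : 0 ≤ ∑ k ∈ (Finset.univ.erase i).erase j, D y k ^ 2 :=
      Finset.sum_nonneg fun _ _ => sq_nonneg _
    have h1 : 0 ≤ y i ^ 2 + y j ^ 2 := by positivity
    have h2 : (Real.cos θ * y i - Real.sin θ * y j -
        θ' * (Real.sin θ * y i + Real.cos θ * y j)) ^ 2 +
        (Real.sin θ * y i + Real.cos θ * y j + θ' * (Real.cos θ * y i - Real.sin θ * y j)) ^ 2 =
        (1 + θ' ^ 2) * (y i ^ 2 + y j ^ 2) := by
      linear_combination (1 + θ' ^ 2) * (y i ^ 2 + y j ^ 2) * h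
    rw [h2]
    linarith
  have h3 : |θ'| * Real.sqrt (y i ^ 2 + y j ^ 2) ≤ ‖D y‖ :=
    (abs_le_of_sq_le_sq' hsq (norm_nonneg _)).2
  refine le_trans (le_of_eq ?_) (h3.trans (D.le_opNorm y))
  rw [hθ', abs_mul, abs_mul, abs_of_nonneg (show 0 ≤ 2 * ‖y‖ ^ 2 / r ^ 2 by positivity)]
  ring

theorem continuous_energyDensity_twist {F : Type*} [NormedAddCommGroup F] [NormedSpace ℝ F]
    (L : (Euc n →L[ℝ] Euc n) →L[ℝ] F) {p : ℝ} (hp : 0 < p) (b : Euc n) (r : ℝ) :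
    Continuous fun q : ℝ × Euc n => ‖L (fderiv ℝ (twist i j b r q.1) q.2)‖ ^ p := by
  have h : ContDiff ℝ 0 fun q : ℝ × Euc n => fderiv ℝ (twist i j b r q.1) q.2 := by
    have h0 : ContDiff ℝ ∞ fun z : (ℝ × Euc n) × Euc n => twist i j b r z.1.1 z.2 :=
      ContDiff.comp (g := fun q : ℝ × Euc n => twist i j b r q.1 q.2)
        (f := fun z : (ℝ × Euc n) × Euc n => (z.1.1, z.2)) (contDiff_twist b r)
        ((contDiff_fst.comp contDiff_fst).prodMk contDiff_snd)
    exact ContDiff.fderiv (f := fun (q : ℝ × Euc n) x => twist i j b r q.1 x) (m := ∞)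
      (g := Prod.snd) h0 contDiff_snd (by simp)
  exact ((L.continuous.comp h.continuous).norm).rpow_const fun _ => Or.inr hp.le

/-- In every ball there is a smooth homeomorphism, equal to the identity off the ball, whose energy
exceeds that of the identity by a prescribed amount: the energy of a twist depends continuously on
its angle and is unbounded. -/
theorem exists_homeomorph_energy_excess_eq (hn : 2 ≤ n) {F : Type*} [NormedAddCommGroup F]
    [NormedSpace ℝ F] (L : (Euc n →L[ℝ] Euc n) →L[ℝ] F) {C : ℝ} (hL : ∀ A, ‖A‖ ≤ C * ‖L A‖)
    {p : ℝ} (hp : 1 ≤ p) (b : Euc n) {r : ℝ} (hr : 0 < r) {m : ℝ} (hm : 0 ≤ m) :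
    ∃ T : Euc n ≃ₜ Euc n, ContDiff ℝ 1 T ∧ (∀ x ∉ Metric.ball b r, T x = x) ∧
      ∫ x in Metric.closedBall b r, (‖L (fderiv ℝ T x)‖ ^ p -
        ‖L (ContinuousLinearMap.id ℝ (Euc n))‖ ^ p) = m := by
  have hp0 : 0 < p := one_pos.trans_le hp
  set i : Fin n := ⟨0, by omega⟩ with hi
  set j : Fin n := ⟨1, by omega⟩ with hj
  have hij : i ≠ j := by simp [hi, hj]
  set B := Metric.closedBall b r with hB
  have hBc : IsCompact B := isCompact_closedBall b r
  set β := ‖L (ContinuousLinearMap.id ℝ (Euc n))‖ ^ p with hβ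
  have hβ0 : 0 ≤ β := by positivity
  set Ψ : ℝ → ℝ := fun t => ∫ x in B, (‖L (fderiv ℝ (twist i j b r t) x)‖ ^ p - β) with hΨ
  have hcont := continuous_energyDensity_twist (i := i) (j := j) L hp0 b r
  have hΨc : Continuous Ψ := by
    refine continuous_parametric_integral_of_continuous
      (f := fun t x => ‖L (fderiv ℝ (twist i j b r t) x)‖ ^ p - β) ?_ hBc
    exact hcont.sub continuous_const
  have hΨ0 : Ψ 0 = 0 := by
    have h1 : twist i j b r 0 = id := funext fun x => twist_zero b r x
    simp only [hΨ, h1, fderiv_id, hβ, sub_self, integral_zero]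
  -- the angle profile has non-zero derivative somewhere
  obtain ⟨s, hs, hs'⟩ : ∃ s ∈ Ioo (0 : ℝ) 1, deriv angleProfile s = -1 := by
    obtain ⟨s, hs, h⟩ := exists_deriv_eq_slope angleProfile one_pos
      contDiff_angleProfile.continuous.continuousOn
      (contDiff_angleProfile.differentiable (by simp)).differentiableOn
    exact ⟨s, hs, by rw [h]; simp [angleProfile]⟩
  set μ : Euc n → ℝ := fun y => |deriv angleProfile (‖y‖ ^ 2 / r ^ 2)| *
    (2 * ‖y‖ ^ 2 / r ^ 2) * Real.sqrt (y i ^ 2 + y j ^ 2) with hμ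
  have hμc : Continuous μ := by
    have h1 : Continuous (deriv angleProfile) := contDiff_angleProfile.continuous_deriv (by simp)
    have h2 : Continuous fun y : Euc n => deriv angleProfile (‖y‖ ^ 2 / r ^ 2) :=
      h1.comp (by fun_prop)
    exact (h2.abs.mul (by fun_prop)).mul (by fun_prop)
  set y₀ : Euc n := EuclideanSpace.single i (Real.sqrt s * r) with hy₀
  have hy₀n : ‖y₀‖ = Real.sqrt s * r := by
    rw [hy₀, PiLp.norm_single, Real.norm_eq_abs, abs_of_nonneg (by positivity)]
  have hμ0 : 0 < μ y₀ := by
    have h1 : ‖y₀‖ ^ 2 / r ^ 2 = s := by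
      rw [hy₀n, mul_pow, Real.sq_sqrt hs.1.le]
      field_simp
    have h2 : y₀ i = Real.sqrt s * r := by simp [hy₀]
    have h3 : 0 < Real.sqrt s * r := mul_pos (Real.sqrt_pos.2 hs.1) hr
    simp only [hμ, h1, hs', h2]
    have h4 : 0 < ‖y₀‖ := by rw [hy₀n]; exact h3
    have h5 : 0 < (Real.sqrt s * r) ^ 2 + y₀ j ^ 2 := by positivity
    have h6 := Real.sqrt_pos.2 h5
    have h7 : 0 < 2 * ‖y₀‖ ^ 2 / r ^ 2 := by positivity
    simp only [abs_neg, abs_one, one_mul]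
    positivity
  set W : Set (Euc n) := {x | μ y₀ / 2 < μ (x - b)} ∩ Metric.ball b r with hW
  have hWo : IsOpen W :=
    (isOpen_lt continuous_const (hμc.comp (continuous_id.sub continuous_const))).inter
      Metric.isOpen_ball
  have hWn : W.Nonempty := ⟨b + y₀, by
    constructor
    · simp only [mem_ofPred_eq, add_sub_cancel_left]; linarith
    · rw [Metric.mem_ball, dist_eq_norm, add_sub_cancel_left, hy₀n]
      have : Real.sqrt s < 1 := by
        rw [Real.sqrt_lt' one_pos]; simpa using hs.2
      nlinarith⟩
  have hWB : W ⊆ B := inter_subset_right.trans Metric.ball_subset_closedBall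
  have hWfin : volume W ≠ ⊤ := ((measure_mono hWB).trans_lt hBc.measure_lt_top).ne
  have hWpos : 0 < volume.real W :=
    ENNReal.toReal_pos (hWo.measure_pos volume hWn).ne' hWfin
  set C' := max C 1 with hC'
  have hC'0 : 0 < C' := lt_max_of_lt_right one_pos
  have hL' : ∀ A, ‖A‖ ≤ C' * ‖L A‖ := fun A => (hL A).trans (by gcongr; exact le_max_left _ _)
  have hlow : ∀ t : ℝ, 0 ≤ t → ∀ x ∈ W,
      (t * (μ y₀ / (2 * r * C'))) ^ p ≤ ‖L (fderiv ℝ (twist i j b r t) x)‖ ^ p := by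
    intro t ht x hx
    have h1 := mul_le_norm_fderiv_twist hij b r t (x - b)
    rw [add_sub_cancel, abs_of_nonneg ht] at h1
    have h2 : ‖x - b‖ ≤ r := by
      have := hx.2
      rw [Metric.mem_ball, dist_eq_norm] at this
      exact this.le
    have h3 : t * (μ y₀ / 2) ≤ C' * ‖L (fderiv ℝ (twist i j b r t) x)‖ * r :=
      calc t * (μ y₀ / 2) ≤ t * μ (x - b) := by
            gcongr
            exact hx.1.le
        _ ≤ _ := h1
        _ ≤ _ := by
            gcongr
            exact hL' _
    refine Real.rpow_le_rpow (by positivity) ?_ hp0.le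
    rw [mul_div_assoc', div_le_iff₀ (by positivity)]
    linarith
  have hint : ∀ t, IntegrableOn (fun x => ‖L (fderiv ℝ (twist i j b r t) x)‖ ^ p) B := fun t =>
    (hcont.comp (Continuous.prodMk_right t)).continuousOn.integrableOn_compact hBc
  have hΨlow : ∀ t : ℝ, 0 ≤ t →
      (t * (μ y₀ / (2 * r * C'))) ^ p * volume.real W - β * volume.real B ≤ Ψ t := by
    intro t ht
    have h1 : Ψ t = (∫ x in B, ‖L (fderiv ℝ (twist i j b r t) x)‖ ^ p) - β * volume.real B := by
      simp only [hΨ]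
      rw [integral_sub (hint t) (integrableOn_const hBc.measure_lt_top.ne)]
      simp [mul_comm]
    rw [h1]
    gcongr
    calc _ = ∫ _x in W, (t * (μ y₀ / (2 * r * C'))) ^ p := by simp [mul_comm]
      _ ≤ ∫ x in W, ‖L (fderiv ℝ (twist i j b r t) x)‖ ^ p :=
        setIntegral_mono_on (integrableOn_const hWfin) ((hint t).mono_set hWB) hWo.measurableSet
          (hlow t ht)
      _ ≤ _ := setIntegral_mono_set (hint t) (Eventually.of_forall fun x => by
          change (0 : ℝ) ≤ _; positivity) hWB.eventuallyLE
  obtain ⟨t, ht0, ht⟩ : ∃ t : ℝ, 0 ≤ t ∧ m ≤ Ψ t := by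
    have h1 : Tendsto (fun t : ℝ => (t * (μ y₀ / (2 * r * C'))) ^ p * volume.real W) atTop atTop :=
      ((tendsto_rpow_atTop hp0).comp (tendsto_id.atTop_mul_const (by positivity))).atTop_mul_const
        hWpos
    obtain ⟨t, ht0, ht⟩ :=
      ((eventually_ge_atTop 0).and (h1.eventually_ge_atTop (m + β * volume.real B))).exists
    exact ⟨t, ht0, by linarith [hΨlow t ht0]⟩
  obtain ⟨τ, -, hτ⟩ := intermediate_value_Icc ht0 hΨc.continuousOn
    (show m ∈ Icc (Ψ 0) (Ψ t) from ⟨by rwa [hΨ0], ht⟩)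
  exact ⟨twistHomeo hij b r τ, (contDiff_twist_right b r τ).of_le (by simp),
    fun x hx => twist_of_notMem_ball hr τ hx, hτ⟩

end Twist

/-! ### Energy excess and gap -/

section Excess

variable {n : ℕ} {F : Type*} [NormedAddCommGroup F] [NormedSpace ℝ F]

/-- The excess of the energy density of a map over that of the identity, in terms of the derivative
`A` of its displacement. -/
noncomputable def excess (L : (Euc n →L[ℝ] Euc n) →L[ℝ] F) (p : ℝ) (A : Euc n →L[ℝ] Euc n) : ℝ :=
  ‖L (ContinuousLinearMap.id ℝ (Euc n) + A)‖ ^ p - ‖L (ContinuousLinearMap.id ℝ (Euc n))‖ ^ p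

theorem excess_zero (L : (Euc n →L[ℝ] Euc n) →L[ℝ] F) (p : ℝ) : excess L p 0 = 0 := by
  simp [excess]

theorem integrable_norm_comp_rpow {α V : Type*} [MeasurableSpace α] {μ : Measure α}
    [NormedAddCommGroup V] [NormedSpace ℝ V] (L : V →L[ℝ] F) {p : ℝ} (hp : 0 < p) {G : α → V}
    (hG : MemLp G (ENNReal.ofReal p) μ) : Integrable (fun x => ‖L (G x)‖ ^ p) μ := by
  have := (L.comp_memLp' hG).integrable_norm_rpow (by simpa using hp) (by simp)
  rwa [ENNReal.toReal_ofReal hp.le] at this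

theorem memLp_restrict_const_add {V : Type*} [NormedAddCommGroup V] {q : ENNReal} {K : Euc n → V}
    (hK : MemLp K q volume) (a : V) :
    MemLp (fun x => a + K x) q (volume.restrict (unitCube n)) :=
  (memLp_const a).add (hK.restrict _)

theorem integrableOn_energy (L : (Euc n →L[ℝ] Euc n) →L[ℝ] F) {p : ℝ} (hp : 0 < p)
    {K : Euc n → (Euc n →L[ℝ] Euc n)} (hK : MemLp K (ENNReal.ofReal p) volume) :
    IntegrableOn (fun x => ‖L (ContinuousLinearMap.id ℝ (Euc n) + K x)‖ ^ p) (unitCube n) :=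
  integrable_norm_comp_rpow L hp (memLp_restrict_const_add hK _)

theorem integrable_excess (L : (Euc n →L[ℝ] Euc n) →L[ℝ] F) {p : ℝ} (hp : 0 < p)
    {K : Euc n → (Euc n →L[ℝ] Euc n)} (hK : MemLp K (ENNReal.ofReal p) volume)
    (hK0 : ∀ x ∉ unitCube n, K x = 0) : Integrable fun x => excess L p (K x) := by
  rw [← integrableOn_iff_integrable_of_support_subset (s := unitCube n) fun x hx => by
    by_contra h
    exact hx (by simp only [hK0 x h, excess_zero])]
  exact (integrableOn_energy L hp hK).sub (integrable_const _)

theorem setIntegral_energy_eq (L : (Euc n →L[ℝ] Euc n) →L[ℝ] F) {p : ℝ} (hp : 0 < p)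
    {K : Euc n → (Euc n →L[ℝ] Euc n)} (hK : MemLp K (ENNReal.ofReal p) volume)
    (hK0 : ∀ x ∉ unitCube n, K x = 0) :
    ∫ x in unitCube n, ‖L (ContinuousLinearMap.id ℝ (Euc n) + K x)‖ ^ p =
      ‖L (ContinuousLinearMap.id ℝ (Euc n))‖ ^ p + ∫ x, excess L p (K x) := by
  have h1 : ∫ x, excess L p (K x) = ∫ x in unitCube n, excess L p (K x) :=
    (setIntegral_eq_integral_of_forall_compl_eq_zero fun x hx => by
      simp only [hK0 x hx, excess_zero]).symm
  rw [h1]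
  unfold excess
  rw [integral_sub (integrableOn_energy L hp hK) (integrable_const _)]
  simp [measureReal_def, volume_unitCube]

/-- The trace as a continuous linear functional. -/
noncomputable def coordTraceCLM (n : ℕ) : (Euc n →L[ℝ] Euc n) →L[ℝ] ℝ :=
  LinearMap.toContinuousLinearMap
    { toFun := coordTrace
      map_add' := fun A B => by simp [coordTrace, Finset.sum_add_distrib]
      map_smul' := fun r A => by simp [coordTrace, Finset.mul_sum] }

theorem coordTraceCLM_apply (A : Euc n →L[ℝ] Euc n) : coordTraceCLM n A = coordTrace A := rfl

/-- The mean of the derivative of a displacement vanishing off the cube is zero. -/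
theorem HasWeakDerivOn.integral_eq_zero {u : Euc n → Euc n} {K : Euc n → (Euc n →L[ℝ] Euc n)}
    (h : HasWeakDerivOn univ u K) (hK : Integrable K) (hu0 : ∀ x ∉ unitCube n, u x = 0)
    (hK0 : ∀ x ∉ unitCube n, K x = 0) : ∫ x, K x = 0 := by
  let φ : ContDiffBump (0 : Euc n) := ⟨Real.sqrt n + 1, Real.sqrt n + 2, by positivity, by linarith⟩
  have hφ1 : ∀ x ∈ Metric.ball (0 : Euc n) (Real.sqrt n + 1), φ x = 1 := fun x hx =>
    φ.one_of_mem_closedBall (Metric.ball_subset_closedBall hx)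
  have hsub : unitCube n ⊆ Metric.ball (0 : Euc n) (Real.sqrt n + 1) :=
    (unitCube_subset_closedBall n).trans (Metric.closedBall_subset_ball (by linarith))
  ext1 v
  have key := (hasWeakDerivOn_iff.1 h).2.2 φ φ.contDiff φ.hasCompactSupport (subset_univ _) v
  have h1 : ∀ x, fderiv ℝ φ x v • u x = 0 := fun x => by
    by_cases hx : x ∈ unitCube n
    · have : (φ : Euc n → ℝ) =ᶠ[𝓝 x] fun _ => 1 := by
        filter_upwards [Metric.isOpen_ball.mem_nhds (hsub hx)] with y hy
        exact hφ1 y hy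
      rw [this.fderiv_eq]; simp
    · rw [hu0 x hx, smul_zero]
  have h2 : ∀ x, φ x • K x v = K x v := fun x => by
    by_cases hx : x ∈ unitCube n
    · rw [hφ1 x (hsub hx), one_smul]
    · rw [hK0 x hx, zero_apply, smul_zero]
  simp only [h1, h2, integral_zero] at key
  rw [ContinuousLinearMap.integral_apply hK, zero_apply]
  exact (neg_eq_zero.1 key.symm)

/-- A map of the cube with identity boundary values and singular derivative has more energy than the
identity. -/
theorem energy_id_lt_of_det_eq_zero (L : (Euc n →L[ℝ] Euc n) →L[ℝ] F) {p : ℝ} (hp : 0 < p)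
    (hI : 0 < ‖L (ContinuousLinearMap.id ℝ (Euc n))‖) {c κ : ℝ} (hc : 0 < c)
    (hgap : ∀ A : Euc n →L[ℝ] Euc n, A.det = 0 →
      ‖L (ContinuousLinearMap.id ℝ (Euc n))‖ ^ p * (1 + c) + κ * (coordTrace A - n) ≤ ‖L A‖ ^ p)
    {u : Euc n → Euc n} {K : Euc n → (Euc n →L[ℝ] Euc n)}
    (h : HasWeakDerivOn univ u K) (hK : Integrable K) (hKp : MemLp K (ENNReal.ofReal p) volume)
    (hu0 : ∀ x ∉ unitCube n, u x = 0) (hK0 : ∀ x ∉ unitCube n, K x = 0)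
    (hdet : ∀ᵐ x ∂(volume.restrict (unitCube n)),
      (ContinuousLinearMap.id ℝ (Euc n) + K x).det = 0) :
    ‖L (ContinuousLinearMap.id ℝ (Euc n))‖ ^ p <
      ∫ x in unitCube n, ‖L (ContinuousLinearMap.id ℝ (Euc n) + K x)‖ ^ p := by
  set β := ‖L (ContinuousLinearMap.id ℝ (Euc n))‖ ^ p with hβ
  have hβ0 : 0 < β := Real.rpow_pos_of_pos hI p
  have htr : ∫ x in unitCube n, coordTraceCLM n (K x) = 0 := by
    rw [setIntegral_eq_integral_of_forall_compl_eq_zero fun x hx => by rw [hK0 x hx, map_zero],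
      (coordTraceCLM n).integral_comp_comm hK, h.integral_eq_zero hK hu0 hK0, map_zero]
  have hti : IntegrableOn (fun x => coordTraceCLM n (K x)) (unitCube n) :=
    ((coordTraceCLM n).integrable_comp hK).integrableOn
  have hle : ∫ x in unitCube n, (β * (1 + c) + κ * coordTraceCLM n (K x)) ≤
      ∫ x in unitCube n, ‖L (ContinuousLinearMap.id ℝ (Euc n) + K x)‖ ^ p := by
    refine integral_mono_ae ((integrable_const _).add (hti.const_mul κ))
      (integrableOn_energy L hp hKp) ?_
    filter_upwards [hdet] with x hx
    have h1 := hgap _ hx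
    have h2 : coordTrace (ContinuousLinearMap.id ℝ (Euc n) + K x) - n = coordTraceCLM n (K x) := by
      rw [← coordTraceCLM_apply, map_add, coordTraceCLM_apply (ContinuousLinearMap.id ℝ (Euc n)),
        coordTrace_id]
      ring
    rwa [h2] at h1
  rw [integral_add (integrable_const _) (hti.const_mul κ),
    integral_const_mul κ fun x => coordTraceCLM n (K x), htr] at hle
  have h3 : ∫ _x in unitCube n, β * (1 + c) = β * (1 + c) := by
    simp [measureReal_def, volume_unitCube]
  rw [h3] at hle
  nlinarith

/-- A map uniformly close to the identity on a ball, with singular derivative, has definitely more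
energy on that ball than the identity. -/
theorem exists_energy_gap_ball (L : (Euc n →L[ℝ] Euc n) →L[ℝ] F) {p : ℝ} (hp : 0 < p)
    (hI : 0 < ‖L (ContinuousLinearMap.id ℝ (Euc n))‖) {c κ : ℝ} (hc : 0 < c)
    (hgap : ∀ A : Euc n →L[ℝ] Euc n, A.det = 0 →
      ‖L (ContinuousLinearMap.id ℝ (Euc n))‖ ^ p * (1 + c) + κ * (coordTrace A - n) ≤ ‖L A‖ ^ p)
    (b : Euc n) {r : ℝ} (hr : 0 < r) :
    ∃ δ > 0, ∃ ε > 0, ∀ (h : Euc n → Euc n) (H : Euc n → (Euc n →L[ℝ] Euc n)),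
      HasWeakDerivOn (Metric.ball b r) h H →
      MemLp H (ENNReal.ofReal p) (volume.restrict (Metric.ball b r)) →
      (∀ x ∈ Metric.ball b r, ‖h x - x‖ ≤ ε) →
      (∀ᵐ x ∂(volume.restrict (Metric.ball b r)), (H x).det = 0) →
      ‖L (ContinuousLinearMap.id ℝ (Euc n))‖ ^ p * volume.real (Metric.ball b r) + δ ≤
        ∫ x in Metric.ball b r, ‖L (H x)‖ ^ p := by
  set β := ‖L (ContinuousLinearMap.id ℝ (Euc n))‖ ^ p with hβ
  have hβ0 : 0 < β := Real.rpow_pos_of_pos hI p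
  set B := Metric.ball b r with hB
  have hvol : 0 < volume.real B :=
    ENNReal.toReal_pos (Metric.measure_ball_pos volume b hr).ne'
      Metric.isBounded_ball.measure_lt_top.ne
  -- the ratio of the radii of a cutoff losing less than the gap
  obtain ⟨s, hs0, hs1, hsc⟩ : ∃ s : ℝ, 0 < s ∧ s < 1 ∧ 1 < s ^ n * (1 + c) := by
    have h1 : Tendsto (fun s : ℝ => s ^ n * (1 + c)) (𝓝[<] 1) (𝓝 (1 ^ n * (1 + c))) :=
      ((continuous_pow n).mul continuous_const).continuousWithinAt
    have h2 : (1 : ℝ) < 1 ^ n * (1 + c) := by rw [one_pow]; linarith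
    obtain ⟨s, hs⟩ := ((h1.eventually_const_lt h2).and
      ((eventually_mem_nhdsWithin).and
        (nhdsWithin_le_nhds (Ioi_mem_nhds (zero_lt_one' ℝ))))).exists
    exact ⟨s, hs.2.2, hs.2.1, hs.1⟩
  let η : ContDiffBump b := ⟨s * r, (1 + s) / 2 * r, by positivity, by nlinarith⟩
  have hηB : tsupport η ⊆ B := by
    rw [η.tsupport_eq]
    refine Metric.closedBall_subset_ball ?_
    change (1 + s) / 2 * r < r
    nlinarith
  set D := ∫ x, ‖fderiv ℝ η x‖ with hD
  have hD0 : 0 ≤ D := integral_nonneg fun _ => norm_nonneg _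
  have hηi : Integrable η := η.continuous.integrable_of_hasCompactSupport η.hasCompactSupport
  have hη : s ^ n * volume.real B ≤ ∫ x, η x := by
    have h1 : volume.real (Metric.ball b (s * r)) = s ^ n * volume.real B := by
      rw [hB, Measure.real, Measure.real, Measure.addHaar_ball_mul_of_pos _ _ hs0,
        ENNReal.toReal_mul, ENNReal.toReal_ofReal (by positivity),
        Measure.addHaar_ball_center volume b r]
      simp
    rw [← h1]
    exact (measureReal_mono Metric.ball_subset_closedBall
      Metric.isBounded_closedBall.measure_lt_top.ne).trans
      (η.measure_closedBall_le_integral volume)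
  set d := β * volume.real B * (s ^ n * (1 + c) - 1) with hd
  have hd0 : 0 < d := by have := sub_pos.2 hsc; positivity
  refine ⟨d / 2, by positivity, d / 2 / (|κ| * (‖coordTraceCLM n‖ * D) + 1), by positivity,
    fun h H hh hHp hclose hdet => ?_⟩
  have hHi : IntegrableOn (fun x => ‖L (H x)‖ ^ p) B := integrable_norm_comp_rpow L hp hHp
  have hidB : HasWeakDerivOn B (fun x : Euc n => x) fun _ => ContinuousLinearMap.id ℝ (Euc n) :=
    hasWeakDerivOn_id.mono (subset_univ _)
  have hsm := hh.norm_integral_smul_sub_le hidB η.contDiff η.hasCompactSupport hηB hclose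
  have hHI : Integrable fun x => η x • (H x - ContinuousLinearMap.id ℝ (Euc n)) := by
    have := (hh.integrable_smul η.contDiff η.hasCompactSupport hηB).sub
      (hidB.integrable_smul η.contDiff η.hasCompactSupport hηB)
    refine this.congr (Eventually.of_forall fun x => ?_)
    simp only [Pi.sub_apply, smul_sub]
  have htr : |∫ x, η x * (coordTrace (H x) - n)| ≤
      ‖coordTraceCLM n‖ * (d / 2 / (|κ| * (‖coordTraceCLM n‖ * D) + 1) * D) := by
    have e : ∀ x, η x * (coordTrace (H x) - n) =
        coordTraceCLM n (η x • (H x - ContinuousLinearMap.id ℝ (Euc n))) := fun x => by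
      rw [map_smul, map_sub, coordTraceCLM_apply, coordTraceCLM_apply, coordTrace_id, smul_eq_mul]
    simp only [e]
    rw [(coordTraceCLM n).integral_comp_comm hHI]
    exact ((coordTraceCLM n).le_opNorm _).trans (by gcongr)
  have hti : Integrable fun x => η x * (coordTrace (H x) - n) := by
    refine ((coordTraceCLM n).integrable_comp hHI).congr (Eventually.of_forall fun x => ?_)
    simp only [map_smul, map_sub, coordTraceCLM_apply, coordTrace_id, smul_eq_mul]
  have hκ : -(d / 2) ≤ κ * ∫ x, η x * (coordTrace (H x) - n) := by
    have h1 : |κ * ∫ x, η x * (coordTrace (H x) - n)| ≤ d / 2 := by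
      rw [abs_mul]
      calc _ ≤ |κ| * (‖coordTraceCLM n‖ * (d / 2 / (|κ| * (‖coordTraceCLM n‖ * D) + 1) * D)) := by
            gcongr
        _ = d / 2 * (|κ| * (‖coordTraceCLM n‖ * D) / (|κ| * (‖coordTraceCLM n‖ * D) + 1)) := by
            ring
        _ ≤ d / 2 * 1 := by
            gcongr
            exact (div_le_one (by positivity)).2 (by linarith)
        _ = d / 2 := mul_one _
    exact (abs_le.1 h1).1
  calc β * volume.real B + d / 2 = β * (1 + c) * (s ^ n * volume.real B) - d / 2 := by
        rw [hd]; ring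
    _ ≤ β * (1 + c) * (∫ x, η x) + κ * ∫ x, η x * (coordTrace (H x) - n) := by
        have := mul_le_mul_of_nonneg_left hη (show 0 ≤ β * (1 + c) by positivity)
        linarith
    _ = ∫ x, (β * (1 + c) * η x + κ * (η x * (coordTrace (H x) - n))) := by
        rw [integral_add (hηi.const_mul _) (hti.const_mul _), integral_const_mul,
          integral_const_mul]
    _ = ∫ x in B, (β * (1 + c) * η x + κ * (η x * (coordTrace (H x) - n))) := by
        refine (setIntegral_eq_integral_of_forall_compl_eq_zero fun x hx => ?_).symm
        rw [image_eq_zero_of_notMem_tsupport fun h => hx (hηB h)]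
        ring
    _ ≤ ∫ x in B, ‖L (H x)‖ ^ p := by
        refine integral_mono_ae ((hηi.const_mul _).add (hti.const_mul _)).integrableOn hHi ?_
        filter_upwards [hdet] with x hx
        have h1 := hgap _ hx
        have h2 : η x * (β * (1 + c) + κ * (coordTrace (H x) - n)) ≤ η x * ‖L (H x)‖ ^ p := by
          gcongr
          exact η.nonneg
        have h3 : η x * ‖L (H x)‖ ^ p ≤ ‖L (H x)‖ ^ p :=
          mul_le_of_le_one_left (by positivity) η.le_one
        linarith

/-- Lower semicontinuity of the energy, in terms of real integrals. -/
theorem exists_lt_setIntegral_of_uniformly_close [CompleteSpace F]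
    (L : (Euc n →L[ℝ] Euc n) →L[ℝ] F) {p : ℝ}
    (hp : 1 ≤ p) {U : Set (Euc n)} (hU : IsOpen U) {g : Euc n → Euc n}
    {G : Euc n → (Euc n →L[ℝ] Euc n)} (hg : HasWeakDerivOn U g G) (hG : IntegrableOn G U)
    (hGp : MemLp G (ENNReal.ofReal p) (volume.restrict U)) {c : ℝ}
    (hc : c < ∫ x in U, ‖L (G x)‖ ^ p) :
    ∃ ε > 0, ∀ (h : Euc n → Euc n) (H : Euc n → (Euc n →L[ℝ] Euc n)), HasWeakDerivOn U h H →
      IntegrableOn H U → MemLp H (ENNReal.ofReal p) (volume.restrict U) →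
      (∀ x ∈ U, ‖h x - g x‖ ≤ ε) → c < ∫ x in U, ‖L (H x)‖ ^ p := by
  have hp0 : 0 < p := one_pos.trans_le hp
  have e : ∀ H : Euc n → (Euc n →L[ℝ] Euc n), MemLp H (ENNReal.ofReal p) (volume.restrict U) →
      ∫⁻ x in U, ‖L (H x)‖ₑ ^ p = ENNReal.ofReal (∫ x in U, ‖L (H x)‖ ^ p) := by
    intro H hH
    rw [ofReal_integral_eq_lintegral_ofReal (integrable_norm_comp_rpow L hp0 hH)
      (Eventually.of_forall fun x => by change (0 : ℝ) ≤ _; positivity)]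
    refine lintegral_congr fun x => ?_
    rw [← ofReal_norm, ENNReal.ofReal_rpow_of_nonneg (norm_nonneg _) hp0.le]
  rcases lt_or_ge c 0 with h0 | h0
  · exact ⟨1, one_pos, fun h H _ _ _ _ => h0.trans_le (integral_nonneg fun x => by
      change (0 : ℝ) ≤ _; positivity)⟩
  have hc' : ENNReal.ofReal c < ∫⁻ x in U, ‖L (G x)‖ₑ ^ p := by
    rw [e G hGp]
    exact (ENNReal.ofReal_lt_ofReal_iff (h0.trans_lt hc)).2 hc
  obtain ⟨ε, hε, h⟩ := exists_lt_lintegral_of_uniformly_close L hp hU hg hG hc'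
  refine ⟨ε, hε, fun h' H hh hH hHp hcl => ?_⟩
  have := h h' H hh hH hcl
  rw [e H hHp] at this
  exact ENNReal.ofReal_lt_ofReal_iff_of_nonneg h0 |>.1 this

end Excess

/-! ### Maps of maximal energy are dense -/

section Dense

variable {n : ℕ} {F : Type*} [NormedAddCommGroup F] [NormedSpace ℝ F]

/-- A homeomorphism of Euclidean space, equal to the identity off the cube, together with the
weak derivative of its displacement. -/
structure HasDisplacementDeriv (Φ : Euc n ≃ₜ Euc n) (K : Euc n → (Euc n →L[ℝ] Euc n)) (p : ℝ) :
    Prop where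
  eq_off : ∀ x ∉ unitCube n, Φ x = x
  deriv_eq_zero : ∀ x ∉ unitCube n, K x = 0
  integrable : Integrable K
  memLp : MemLp K (ENNReal.ofReal p) volume
  hasWeakDeriv : HasWeakDerivOn univ (fun x => Φ x - x) K

theorem HasDisplacementDeriv.hasWeakDerivOn {Φ : Euc n ≃ₜ Euc n}
    {K : Euc n → (Euc n →L[ℝ] Euc n)} {p : ℝ} (h : HasDisplacementDeriv Φ K p)
    (U : Set (Euc n)) :
    HasWeakDerivOn U Φ fun x => ContinuousLinearMap.id ℝ (Euc n) + K x := by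
  have h1 := (hasWeakDerivOn_id.add h.hasWeakDeriv).mono (subset_univ U)
  simpa only [add_sub_cancel] using h1

theorem integrable_of_memLp_of_eq_zero_off {V : Type*} [NormedAddCommGroup V] {p : ℝ} (hp : 1 ≤ p)
    {K : Euc n → V} (hK : MemLp K (ENNReal.ofReal p) (volume.restrict (unitCube n)))
    (hK0 : ∀ x ∉ unitCube n, K x = 0) : Integrable K := by
  have h1 : IntegrableOn K (unitCube n) :=
    hK.integrable (by rw [← ENNReal.ofReal_one]; exact ENNReal.ofReal_le_ofReal hp)
  rwa [integrableOn_iff_integrable_of_support_subset fun x hx => by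
    by_contra h; exact hx (hK0 x h)] at h1

theorem memLp_indicator_unitCube {V : Type*} [NormedAddCommGroup V] {q : ENNReal} {G : Euc n → V}
    (hG : MemLp G q (volume.restrict (unitCube n))) :
    MemLp ((unitCube n).indicator G) q volume :=
  (memLp_indicator_iff_restrict (measurableSet_unitCube n)).2 hG

/-- An element of the space, extended by the identity, has a displacement with a global weak
derivative: the given one minus the identity on the cube, and zero off it. -/
theorem SobolevHomeo.exists_displacementDeriv {p M : ℝ} (hp : 1 ≤ p)
    {N : (Euc n →L[ℝ] Euc n) → ℝ} (f : SobolevHomeo n p M N) :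
    ∃ (Φ : Euc n ≃ₜ Euc n) (K : Euc n → (Euc n →L[ℝ] Euc n)), HasDisplacementDeriv Φ K p ∧
      (∀ x, Φ x = cubeExtend f.toHomeo x) ∧ (∀ x, Φ.symm x = cubeExtend f.toHomeo.symm x) ∧
      ∫ x in unitCube n, N (ContinuousLinearMap.id ℝ (Euc n) + K x) ^ p ≤ M := by
  obtain ⟨Φ, hΦ, hΦs⟩ := exists_homeomorph_cubeExtend f.toHomeo f.boundary
  obtain ⟨G, hG, -, hGp, hGM⟩ := f.sobolev
  have hoff : ∀ x ∉ unitCube n, Φ x = x := fun x hx => by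
    rw [hΦ, cubeExtend_of_notMem _ hx]
  set K : Euc n → (Euc n →L[ℝ] Euc n) := (unitCube n).indicator
    fun x => G x - ContinuousLinearMap.id ℝ (Euc n) with hK
  have hK0 : ∀ x ∉ unitCube n, K x = 0 := fun x hx => indicator_of_notMem hx _
  have hKQ : ∀ x ∈ unitCube n, K x = G x - ContinuousLinearMap.id ℝ (Euc n) := fun x hx =>
    indicator_of_mem hx _
  have hKp : MemLp K (ENNReal.ofReal p) volume :=
    memLp_indicator_unitCube (hGp.sub (memLp_const _))
  have hKi : Integrable K := integrable_of_memLp_of_eq_zero_off hp (hKp.restrict _) hK0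
  have hcont : Continuous fun x => Φ x - x := Φ.continuous.sub continuous_id
  have hQ : HasWeakDerivOn (unitCube n) (fun x => Φ x - x) K := by
    have hid := (hasWeakDerivOn_id (n := n)).mono (subset_univ (unitCube n))
    rw [hasWeakDerivOn_iff]
    refine ⟨hcont.locallyIntegrable.locallyIntegrableOn _,
      hKi.locallyIntegrable.locallyIntegrableOn _, fun φ hφ hc hs v => ?_⟩
    have e1 : ∀ x, fderiv ℝ φ x v • (Φ x - x) =
        fderiv ℝ φ x v • cubeExtend f.toHomeo x - fderiv ℝ φ x v • x := fun x => by
      rw [smul_sub, hΦ]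
    have e2 : ∀ x, φ x • K x v = φ x • G x v - φ x • ContinuousLinearMap.id ℝ (Euc n) v :=
      fun x => by
        by_cases hx : x ∈ unitCube n
        · rw [hKQ x hx, sub_apply, smul_sub]
        · rw [image_eq_zero_of_notMem_tsupport fun h => hx (hs h)]
          simp only [zero_smul, sub_zero]
    simp only [e1, e2]
    rw [integral_sub (hG.integrable_fderiv_smul hφ hc hs v) (hid.integrable_fderiv_smul hφ hc hs v),
      integral_sub (hG.integrable_smul_apply hφ hc hs v) (hid.integrable_smul_apply hφ hc hs v),
      (hasWeakDerivOn_iff.1 hG).2.2 φ hφ hc hs v, (hasWeakDerivOn_iff.1 hid).2.2 φ hφ hc hs v]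
    abel
  refine ⟨Φ, K, ⟨hoff, hK0, hKi, hKp, ?_⟩, hΦ, hΦs, ?_⟩
  · exact hQ.univ_of_unitCube hcont (fun x hx => by rw [hoff x hx, sub_self]) hKi hK0
  · refine (setIntegral_congr_fun (measurableSet_unitCube n) fun x hx => ?_).trans_le hGM
    simp only [hKQ x hx, add_sub_cancel]

theorem HasDisplacementDeriv.exists_sobolevHomeo {p M : ℝ} {N : (Euc n →L[ℝ] Euc n) → ℝ}
    {Φ : Euc n ≃ₜ Euc n} {K : Euc n → (Euc n →L[ℝ] Euc n)} (h : HasDisplacementDeriv Φ K p)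
    (hM : ∫ x in unitCube n, N (ContinuousLinearMap.id ℝ (Euc n) + K x) ^ p ≤ M) :
    ∃ g : SobolevHomeo n p M N, (∀ x, cubeExtend g.toHomeo x = Φ x) ∧
      ∀ x, cubeExtend g.toHomeo.symm x = Φ.symm x := by
  obtain ⟨g, hg, hgs, hgb⟩ := exists_cube_homeomorph Φ h.eq_off
  have hfun : cubeExtend g = Φ := funext hg
  refine ⟨⟨g, hgb, fun x => ContinuousLinearMap.id ℝ (Euc n) + K x, ?_, ?_, ?_, hM⟩, hg, hgs⟩
  · rw [hfun]; exact h.hasWeakDerivOn _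
  · rw [hfun]
    refine MemLp.of_bound Φ.continuous.aestronglyMeasurable (Real.sqrt n) ?_
    refine ae_restrict_of_forall_mem (measurableSet_unitCube n) fun x hx => ?_
    rw [← hg, cubeExtend_of_mem _ hx]
    exact norm_le_of_mem_unitCube (g ⟨x, hx⟩).2
  · exact memLp_restrict_const_add h.memLp _

/-- The centre of the cube. -/
noncomputable def cubeCenter (n : ℕ) : Euc n := WithLp.toLp 2 fun _ => 1 / 2

theorem homothetyAt_cubeCenter_apply (s : ℝ) (x : Euc n) (i : Fin n) :
    homothetyAt (cubeCenter n) s x i = 1 / 2 + s * (x i - 1 / 2) := by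
  simp [homothetyAt, cubeCenter]

theorem homothetyAt_inv_notMem_unitCube {s : ℝ} (hs0 : 0 < s) (hs1 : s < 1) {x : Euc n}
    (hx : x ∉ unitCube n) : homothetyAt (cubeCenter n) s⁻¹ x ∉ unitCube n := by
  intro h
  refine hx fun i => ?_
  have h1 := h i
  rw [homothetyAt_cubeCenter_apply] at h1
  have h2 : x i - 1 / 2 = s * (s⁻¹ * (x i - 1 / 2)) := by
    rw [← mul_assoc, mul_inv_cancel₀ hs0.ne', one_mul]
  constructor <;> nlinarith [h1.1, h1.2]

/-- The conjugate of a homeomorphism by the homothety of ratio `s` about the centre of the cube. -/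
noncomputable def rescale (s : ℝ) (hs : s ≠ 0) (Φ : Euc n ≃ₜ Euc n) : Euc n ≃ₜ Euc n :=
  ((homothetyHomeo (cubeCenter n) hs).symm.trans Φ).trans (homothetyHomeo (cubeCenter n) hs)

theorem rescale_apply_sub {s : ℝ} (hs : s ≠ 0) (Φ : Euc n ≃ₜ Euc n) (x : Euc n) :
    rescale s hs Φ x - x = s • (Φ (homothetyAt (cubeCenter n) s⁻¹ x) -
      homothetyAt (cubeCenter n) s⁻¹ x) := by
  have h1 : rescale s hs Φ x =
      homothetyAt (cubeCenter n) s (Φ (homothetyAt (cubeCenter n) s⁻¹ x)) := rfl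
  conv_lhs => rw [h1, ← homothetyAt_inv_cancel (cubeCenter n) hs x]
  rw [homothetyAt_cancel _ hs]
  generalize homothetyAt (cubeCenter n) s⁻¹ x = y
  simp only [homothetyAt, smul_sub]
  abel

theorem rescale_symm {s : ℝ} (hs : s ≠ 0) (Φ : Euc n ≃ₜ Euc n) :
    (rescale s hs Φ).symm = rescale s hs Φ.symm := rfl

theorem rescale_apply_eq_self {s : ℝ} (hs : s ≠ 0) {Φ : Euc n ≃ₜ Euc n}
    (hΦ : ∀ x ∉ unitCube n, Φ x = x) {x : Euc n}
    (hx : homothetyAt (cubeCenter n) s⁻¹ x ∉ unitCube n) : rescale s hs Φ x = x := by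
  have h := rescale_apply_sub hs Φ x
  rw [hΦ _ hx, sub_self, smul_zero] at h
  exact sub_eq_zero.1 h

theorem HasDisplacementDeriv.rescale {p : ℝ} (hp : 0 < p) {Φ : Euc n ≃ₜ Euc n}
    {K : Euc n → (Euc n →L[ℝ] Euc n)} (h : HasDisplacementDeriv Φ K p) {s : ℝ} (hs0 : 0 < s)
    (hs1 : s < 1) :
    HasDisplacementDeriv (rescale s hs0.ne' Φ)
      (fun x => K (homothetyAt (cubeCenter n) s⁻¹ x)) p where
  eq_off x hx := rescale_apply_eq_self _ h.eq_off (homothetyAt_inv_notMem_unitCube hs0 hs1 hx)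
  deriv_eq_zero x hx := h.deriv_eq_zero _ (homothetyAt_inv_notMem_unitCube hs0 hs1 hx)
  integrable := integrable_comp_homothetyAt _ hs0 h.integrable
  memLp := by
    have hp' : ENNReal.ofReal p ≠ 0 := by simpa using hp
    rw [← integrable_norm_rpow_iff (integrable_comp_homothetyAt _ hs0 h.integrable).1 hp' (by simp)]
    exact integrable_comp_homothetyAt _ hs0 (h.memLp.integrable_norm_rpow hp' (by simp))
  hasWeakDeriv := by
    have h1 := h.hasWeakDeriv.comp_homothetyAt (Φ.continuous.sub continuous_id) h.integrable
      (cubeCenter n) hs0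
    simpa only [rescale_apply_sub] using h1

theorem norm_cubeCenter_sub_le {x : Euc n} (hx : x ∈ unitCube n) :
    ‖x - cubeCenter n‖ ≤ 2 * Real.sqrt n := by
  have h1 : cubeCenter n ∈ unitCube n := fun i => by simp [cubeCenter]; norm_num
  linarith [norm_sub_le x (cubeCenter n), norm_le_of_mem_unitCube hx, norm_le_of_mem_unitCube h1]

/-- The rescaled maps tend uniformly to the original one as the ratio tends to `1`. -/
theorem eventually_norm_rescale_sub_le {Φ : Euc n ≃ₜ Euc n} (hΦ : ∀ x ∉ unitCube n, Φ x = x)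
    {ε : ℝ} (hε : 0 < ε) : ∀ᶠ s in 𝓝[<] (1 : ℝ), ∀ hs : s ≠ 0, ∀ x ∈ unitCube n,
      ‖rescale s hs Φ x - Φ x‖ ≤ ε := by
  set u : Euc n → Euc n := fun x => Φ x - x with hu
  have huc : Continuous u := Φ.continuous.sub continuous_id
  have hucs : HasCompactSupport u := HasCompactSupport.of_support_subset_isCompact
    (isCompact_closedBall (0 : Euc n) (Real.sqrt n)) fun x hx =>
      unitCube_subset_closedBall n (by_contra fun h => hx (by simp only [hu, hΦ x h, sub_self]))
  obtain ⟨B, hB⟩ := huc.bounded_above_of_compact_support hucs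
  have hB0 : 0 ≤ B := (norm_nonneg _).trans (hB 0)
  obtain ⟨ρ, hρ, hρu⟩ := Metric.uniformContinuous_iff.1
    (hucs.uniformContinuous_of_continuous huc) (ε / 2) (by positivity)
  have t1 : Tendsto (fun s : ℝ => (s⁻¹ - 1) * (2 * Real.sqrt n)) (𝓝[<] 1) (𝓝 0) := by
    have h1 : Tendsto (fun s : ℝ => s⁻¹) (𝓝 1) (𝓝 1⁻¹) := tendsto_inv₀ one_ne_zero
    have h2 := ((h1.sub_const 1).mul_const (2 * Real.sqrt n)).mono_left
      (nhdsWithin_le_nhds (s := Iio (1 : ℝ)))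
    simpa using h2
  have t2 : Tendsto (fun s : ℝ => (1 - s) * B) (𝓝[<] 1) (𝓝 0) := by
    have h2 := ((tendsto_id (α := ℝ) (x := 𝓝 1)).const_sub 1 |>.mul_const B).mono_left
      (nhdsWithin_le_nhds (s := Iio (1 : ℝ)))
    simpa using h2
  filter_upwards [t1.eventually_lt_const hρ, t2.eventually_lt_const (half_pos hε),
    eventually_mem_nhdsWithin, nhdsWithin_le_nhds (Ioi_mem_nhds (zero_lt_one' ℝ))]
    with s h1 h2 hs1 hs0 hs x hx
  have hs1' : s < 1 := hs1
  have hs0' : 0 < s := hs0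
  set y := homothetyAt (cubeCenter n) s⁻¹ x with hy
  have hyx : dist y x < ρ := by
    have e : y - x = (s⁻¹ - 1) • (x - cubeCenter n) := by
      rw [hy, homothetyAt, sub_smul, one_smul]; abel
    have h3 : 0 ≤ s⁻¹ - 1 := sub_nonneg.2 ((one_le_inv₀ hs0').2 hs1'.le)
    rw [dist_eq_norm, e, norm_smul, Real.norm_eq_abs, abs_of_nonneg h3]
    refine lt_of_le_of_lt ?_ h1
    gcongr
    exact norm_cubeCenter_sub_le hx
  have hux := hρu hyx
  rw [dist_eq_norm] at hux
  have e : rescale s hs Φ x - Φ x = s • (u y - u x) - (1 - s) • u x := by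
    have h3 := rescale_apply_sub hs Φ x
    have h4 : rescale s hs Φ x - Φ x = (rescale s hs Φ x - x) - u x := by
      simp only [hu]; abel
    rw [h4, h3, smul_sub s (u y), sub_smul, one_smul]
    abel
  rw [e]
  calc _ ≤ ‖s • (u y - u x)‖ + ‖(1 - s) • u x‖ := norm_sub_le _ _
    _ ≤ 1 * (ε / 2) + (1 - s) * B := by
      rw [norm_smul, norm_smul, Real.norm_eq_abs, Real.norm_eq_abs, abs_of_pos hs0',
        abs_of_pos (sub_pos.2 hs1')]
      gcongr
      exact hB x
    _ ≤ ε := by linarith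

/-- Balls near the two ends of the cube in the first coordinate direction, in the region where
rescaled maps are the identity. -/
theorem exists_disjoint_closedBalls (hn : 0 < n) {s r : ℝ} (hs0 : 0 < s) (hs1 : s < 1)
    (hr : r < (1 - s) / 4) :
    ∃ b₁ b₂ : Euc n, Disjoint (Metric.closedBall b₁ r) (Metric.closedBall b₂ r) ∧
      (∀ x ∈ Metric.closedBall b₁ r, x ∈ unitCube n ∧
        homothetyAt (cubeCenter n) s⁻¹ x ∉ unitCube n) ∧
      (∀ x ∈ Metric.closedBall b₂ r, x ∈ unitCube n ∧
        homothetyAt (cubeCenter n) s⁻¹ x ∉ unitCube n) := by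
  set i : Fin n := ⟨0, hn⟩
  set b : ℝ → Euc n := fun a => cubeCenter n + EuclideanSpace.single i a with hb
  have hcoord : ∀ a x, x ∈ Metric.closedBall (b a) r →
      ∀ k, |x k - (1 / 2 + if k = i then a else 0)| ≤ r := by
    intro a x hx k
    rw [Metric.mem_closedBall, dist_eq_norm] at hx
    have h1 := (PiLp.norm_apply_le (x - b a) k).trans hx
    simpa [hb, cubeCenter, Pi.single_apply, Real.norm_eq_abs] using h1
  have hmem : ∀ a, |a| = (1 + s) / 4 → ∀ x ∈ Metric.closedBall (b a) r, x ∈ unitCube n := by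
    intro a ha x hx k
    have h1 := abs_le.1 (hcoord a x hx k)
    have h2 := abs_le.1 ha.le
    split_ifs at h1 <;> constructor <;> linarith [h1.1, h1.2, h2.1, h2.2]
  refine ⟨b ((1 + s) / 4), b (-((1 + s) / 4)), ?_, fun x hx => ⟨hmem _ ?_ x hx, fun h => ?_⟩,
    fun x hx => ⟨hmem _ ?_ x hx, fun h => ?_⟩⟩
  · rw [disjoint_left]
    intro x hx1 hx2
    have h1 := abs_le.1 (hcoord _ x hx1 i)
    have h2 := abs_le.1 (hcoord _ x hx2 i)
    simp only [if_true] at h1 h2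
    linarith [h1.1, h2.2]
  · exact abs_of_pos (by linarith)
  · have h1 := abs_le.1 (hcoord _ x hx i)
    have h2 := (h i).2
    rw [homothetyAt_cubeCenter_apply] at h2
    simp only [if_true] at h1
    have h3 : s⁻¹ * (s / 2) ≤ s⁻¹ * (x i - 1 / 2) := by
      gcongr
      linarith [h1.1]
    have h4 : s⁻¹ * (s / 2) = 1 / 2 := by field_simp
    linarith
  · rw [abs_neg]
    exact abs_of_pos (by linarith)
  · have h1 := abs_le.1 (hcoord _ x hx i)
    have h2 := (h i).1
    rw [homothetyAt_cubeCenter_apply] at h2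
    simp only [if_true] at h1
    have h3 : s⁻¹ * (x i - 1 / 2) ≤ s⁻¹ * (-(s / 2)) := by
      gcongr
      linarith [h1.2]
    have h4 : s⁻¹ * (-(s / 2)) = -(1 / 2) := by field_simp
    linarith

end Dense

section Integrability

variable {n : ℕ} {W : Type*} [NormedAddCommGroup W]

theorem MeasureTheory.Integrable.add_of_hasCompactSupport {K k : Euc n → W}
    (hK : Integrable K volume) (hk : Continuous k) (hks : HasCompactSupport k) :
    Integrable (fun x => K x + k x) volume :=
  hK.add (hk.integrable_of_hasCompactSupport hks)

theorem MeasureTheory.MemLp.add_of_hasCompactSupport {q : ENNReal} {K k : Euc n → W}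
    (hK : MemLp K q volume) (hk : Continuous k) (hks : HasCompactSupport k) :
    MemLp (fun x => K x + k x) q volume :=
  hK.add (hk.memLp_of_hasCompactSupport hks)

theorem MeasureTheory.Integrable.const_add_integrableOn {S : Set (Euc n)} (hS : volume S ≠ ⊤)
    {K : Euc n → W} (hK : Integrable K volume) (a : W) : IntegrableOn (fun x => a + K x) S :=
  (integrableOn_const hS).add hK.integrableOn

end Integrability

section Maximal

variable {n : ℕ} {F : Type*} [NormedAddCommGroup F] [NormedSpace ℝ F]

theorem fderiv_eq_id_of_notMem_closedBall {T : Euc n ≃ₜ Euc n} {b : Euc n} {r : ℝ}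
    (hT : ∀ x ∉ Metric.ball b r, T x = x) {x : Euc n} (hx : x ∉ Metric.closedBall b r) :
    fderiv ℝ T x = ContinuousLinearMap.id ℝ (Euc n) := by
  have h : (T : Euc n → Euc n) =ᶠ[𝓝 x] id := by
    filter_upwards [Metric.isClosed_closedBall.isOpen_compl.mem_nhds hx] with y hy
    exact hT y fun h => hy (Metric.ball_subset_closedBall h)
  rw [h.fderiv_eq, fderiv_id]

/-- Composing with a smooth homeomorphism supported in a ball on which `Φ` is the identity adds the
displacements. -/
theorem trans_apply_eq_add {Φ T : Euc n ≃ₜ Euc n} {b : Euc n} {r : ℝ}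
    (hΦ : ∀ x ∈ Metric.closedBall b r, Φ x = x) (hT : ∀ x ∉ Metric.ball b r, T x = x) (x : Euc n) :
    (T.trans Φ) x = Φ x + (T x - x) := by
  have h : (T.trans Φ) x = Φ (T x) := rfl
  rw [h]
  by_cases hx : x ∈ Metric.ball b r
  · have h1 : T x ∈ Metric.ball b r := (mem_iff_of_eq_off T.toEquiv hT x).1 hx
    rw [hΦ _ (Metric.ball_subset_closedBall h1), hΦ _ (Metric.ball_subset_closedBall hx)]
    abel
  · rw [hT x hx, sub_self, add_zero]

theorem HasDisplacementDeriv.trans_of_ball {p : ℝ} {Φ T : Euc n ≃ₜ Euc n}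
    {K : Euc n → (Euc n →L[ℝ] Euc n)} (h : HasDisplacementDeriv Φ K p) {b : Euc n} {r : ℝ}
    (hb : Metric.closedBall b r ⊆ unitCube n) (hΦ : ∀ x ∈ Metric.closedBall b r, Φ x = x)
    (hT : ∀ x ∉ Metric.ball b r, T x = x) (hTd : ContDiff ℝ 1 T) :
    HasDisplacementDeriv (T.trans Φ)
      (fun x => K x + (fderiv ℝ T x - ContinuousLinearMap.id ℝ (Euc n))) p := by
  have hcont : Continuous fun x => fderiv ℝ T x - ContinuousLinearMap.id ℝ (Euc n) :=
    (hTd.continuous_fderiv (by simp)).sub continuous_const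
  have hcs : HasCompactSupport fun x => fderiv ℝ T x - ContinuousLinearMap.id ℝ (Euc n) :=
    HasCompactSupport.of_support_subset_isCompact (isCompact_closedBall b r) fun x hx => by
      by_contra hxb
      exact hx (by simp only [fderiv_eq_id_of_notMem_closedBall hT hxb, sub_self])
  refine ⟨fun x hx => ?_, fun x hx => ?_, ?_, ?_, ?_⟩
  · have hxb : x ∉ Metric.ball b r := fun h => hx (hb (Metric.ball_subset_closedBall h))
    rw [trans_apply_eq_add hΦ hT, h.eq_off x hx, hT x hxb, sub_self, add_zero]
  · rw [h.deriv_eq_zero x hx, fderiv_eq_id_of_notMem_closedBall hT fun h => hx (hb h), sub_self,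
      add_zero]
  · exact h.integrable.add_of_hasCompactSupport hcont hcs
  · exact h.memLp.add_of_hasCompactSupport hcont hcs
  · have h1 := hasWeakDerivOn_fderiv (hTd.sub contDiff_id)
    have h2 : fderiv ℝ (fun x => T x - id x) =
        fun x => fderiv ℝ T x - ContinuousLinearMap.id ℝ (Euc n) := by
      ext1 x
      rw [fderiv_fun_sub (hTd.differentiable (by simp) x) differentiableAt_id, fderiv_id]
    have h1' : HasWeakDerivOn univ (fun x => T x - id x)
        (fun x => fderiv ℝ T x - ContinuousLinearMap.id ℝ (Euc n)) := h2 ▸ h1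
    have h3 := h.hasWeakDeriv.add h1'
    have h4 : ∀ x, (T.trans Φ) x - x = Φ x - x + (T x - id x) := fun x => by
      rw [trans_apply_eq_add hΦ hT, id]; abel
    simpa only [h4] using h3

theorem HasDisplacementDeriv.integral_excess_trans_of_ball {p : ℝ} (hp : 0 < p)
    (L : (Euc n →L[ℝ] Euc n) →L[ℝ] F) {Φ T : Euc n ≃ₜ Euc n}
    {K : Euc n → (Euc n →L[ℝ] Euc n)} (h : HasDisplacementDeriv Φ K p) {b : Euc n} {r : ℝ}
    (hK : ∀ x ∈ Metric.closedBall b r, K x = 0)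
    (hT : ∀ x ∉ Metric.ball b r, T x = x) (hTd : ContDiff ℝ 1 T) :
    ∫ x, excess L p (K x + (fderiv ℝ T x - ContinuousLinearMap.id ℝ (Euc n))) =
      (∫ x, excess L p (K x)) + ∫ x in Metric.closedBall b r, (‖L (fderiv ℝ T x)‖ ^ p -
        ‖L (ContinuousLinearMap.id ℝ (Euc n))‖ ^ p) := by
  have hc : Continuous fun x => ‖L (fderiv ℝ T x)‖ ^ p -
      ‖L (ContinuousLinearMap.id ℝ (Euc n))‖ ^ p :=
    ((L.continuous.comp (hTd.continuous_fderiv (by simp))).norm.rpow_const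
      fun _ => Or.inr hp.le).sub continuous_const
  have hm : MeasurableSet (Metric.closedBall b r) := Metric.isClosed_closedBall.measurableSet
  rw [← integral_indicator hm, ← integral_add (integrable_excess L hp h.memLp h.deriv_eq_zero)
    ((hc.continuousOn.integrableOn_compact (isCompact_closedBall b r)).integrable_indicator hm)]
  congr 1
  ext1 x
  by_cases hx : x ∈ Metric.closedBall b r
  · rw [indicator_of_mem hx, hK x hx, excess_zero, zero_add, zero_add, excess, add_sub_cancel]
  · rw [indicator_of_notMem hx, fderiv_eq_id_of_notMem_closedBall hT hx, sub_self, add_zero,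
      add_zero]

/-- The maps of maximal energy which are the identity on some ball are dense: rescaling a map
decreases its energy and frees a region near the boundary, where a twist restores the energy. -/
theorem SobolevHomeo.exists_dist_lt_energy_eq (hn : 2 ≤ n) (L : (Euc n →L[ℝ] Euc n) →L[ℝ] F)
    {C : ℝ} (hL : ∀ A, ‖A‖ ≤ C * ‖L A‖) {p M : ℝ} (hp : 1 ≤ p)
    {N : (Euc n →L[ℝ] Euc n) → ℝ} (hN : ∀ A, N A = ‖L A‖)
    (hM : ‖L (ContinuousLinearMap.id ℝ (Euc n))‖ ^ p < M) (f : SobolevHomeo n p M N)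
    {ε : ℝ} (hε : 0 < ε) :
    ∃ (g : SobolevHomeo n p M N) (Ψ : Euc n ≃ₜ Euc n) (K : Euc n → (Euc n →L[ℝ] Euc n))
      (b : Euc n) (r : ℝ), dist g f < ε ∧ 0 < r ∧ Metric.closedBall b r ⊆ unitCube n ∧
      HasDisplacementDeriv Ψ K p ∧ (∀ x, cubeExtend g.toHomeo x = Ψ x) ∧
      (∀ x ∈ Metric.closedBall b r, Ψ x = x ∧ K x = 0) ∧
      ∫ x in unitCube n, ‖L (ContinuousLinearMap.id ℝ (Euc n) + K x)‖ ^ p = M := by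
  have hp0 : 0 < p := one_pos.trans_le hp
  set β := ‖L (ContinuousLinearMap.id ℝ (Euc n))‖ ^ p with hβ
  obtain ⟨Φ, K, hK, hΦ, hΦs, hE⟩ := f.exists_displacementDeriv hp
  simp only [hN] at hE
  rw [setIntegral_energy_eq L hp0 hK.memLp hK.deriv_eq_zero] at hE
  set e := ∫ x, excess L p (K x) with he
  have hsoff : ∀ x ∉ unitCube n, Φ.symm x = x := fun x hx => by
    rw [hΦs, cubeExtend_of_notMem _ hx]
  -- the ratio of the rescaling
  obtain ⟨s, ⟨hs1, hs2⟩, hslt, hspos⟩ :=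
    ((((eventually_norm_rescale_sub_le hK.eq_off (show 0 < ε / 8 by positivity))).and
      (eventually_norm_rescale_sub_le hsoff (show 0 < ε / 8 by positivity))).and
      (eventually_mem_nhdsWithin.and (nhdsWithin_le_nhds (Ioi_mem_nhds (zero_lt_one' ℝ))))).exists
  have hs1' : s < 1 := hslt
  have hs0 : 0 < s := hspos
  set Φs := _root_.rescale s hs0.ne' Φ with hΦsdef
  set Ks : Euc n → (Euc n →L[ℝ] Euc n) := fun x => K (homothetyAt (cubeCenter n) s⁻¹ x) with hKsdef
  have hKs : HasDisplacementDeriv Φs Ks p := hK.rescale hp0 hs0 hs1'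
  have hes : ∫ x, excess L p (Ks x) = s ^ n * e := by
    rw [hKsdef, integral_comp_homothetyAt _ hs0 (fun x => excess L p (K x)), smul_eq_mul]
  -- the balls in the freed region
  set r := min ((1 - s) / 8) (ε / 16) with hr
  have hr0 : 0 < r := lt_min (by linarith) (by positivity)
  have hr1 : r < (1 - s) / 4 := (min_le_left _ _).trans_lt (by linarith)
  have hr2 : 2 * r ≤ ε / 8 := by
    have := min_le_right ((1 - s) / 8) (ε / 16)
    linarith
  obtain ⟨b₁, b₂, hdisj, hb₁, hb₂⟩ := exists_disjoint_closedBalls (n := n) (by omega) hs0 hs1' hr1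
  have hid : ∀ x, homothetyAt (cubeCenter n) s⁻¹ x ∉ unitCube n → Φs x = x ∧ Ks x = 0 :=
    fun x hx => ⟨rescale_apply_eq_self _ hK.eq_off hx, hK.deriv_eq_zero _ hx⟩
  -- the twist restoring the energy
  have hm : 0 ≤ M - β - s ^ n * e := by
    have h1 : s ^ n ≤ 1 := pow_le_one₀ hs0.le hs1'.le
    have h2 : s ^ n * e ≤ s ^ n * (M - β) := by
      gcongr
      linarith
    have h3 : s ^ n * (M - β) ≤ 1 * (M - β) :=
      mul_le_mul_of_nonneg_right h1 (by linarith)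
    linarith
  obtain ⟨T, hTd, hT, hTm⟩ := exists_homeomorph_energy_excess_eq hn L hL hp b₂ hr0 hm
  have hΦs2 : ∀ x ∈ Metric.closedBall b₂ r, Φs x = x := fun x hx => (hid x (hb₂ x hx).2).1
  have hKs2 : ∀ x ∈ Metric.closedBall b₂ r, Ks x = 0 := fun x hx => (hid x (hb₂ x hx).2).2
  have hg := hKs.trans_of_ball (fun x hx => (hb₂ x hx).1) hΦs2 hT hTd
  have hgE : ∫ x in unitCube n, ‖L (ContinuousLinearMap.id ℝ (Euc n) +
      (Ks x + (fderiv ℝ T x - ContinuousLinearMap.id ℝ (Euc n))))‖ ^ p = M := by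
    rw [setIntegral_energy_eq L hp0 hg.memLp hg.deriv_eq_zero,
      hKs.integral_excess_trans_of_ball hp0 L hKs2 hT hTd, hes, hTm]
    ring
  obtain ⟨g, hgΨ, hgΨs⟩ := hg.exists_sobolevHomeo (N := N) (M := M)
    (by simp only [hN]; exact hgE.le)
  have hTr : ∀ S : Euc n ≃ₜ Euc n, (∀ x ∉ Metric.ball b₂ r, S x = x) → ∀ x, ‖S x - x‖ ≤ ε / 8 := by
    intro S hS x
    by_cases hx : x ∈ Metric.ball b₂ r
    · have h1 : S x ∈ Metric.ball b₂ r := (mem_iff_of_eq_off S.toEquiv hS x).1 hx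
      rw [Metric.mem_ball] at h1 hx
      rw [← dist_eq_norm]
      linarith [dist_triangle_right (S x) x b₂]
    · rw [hS x hx, sub_self, norm_zero]; positivity
  have hTs : ∀ x ∉ Metric.ball b₂ r, T.symm x = x := fun x hx => by
    conv_lhs => rw [← hT x hx]
    exact T.symm_apply_apply x
  refine ⟨g, T.trans Φs, _, b₁, r, ?_, hr0, fun x hx => (hb₁ x hx).1, hg, hgΨ, fun x hx => ?_, hgE⟩
  · have d1 : supDist g.toHomeo f.toHomeo ≤ ε / 4 := by
      refine supDist_le_of_cubeExtend (by positivity) fun x hx => ?_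
      rw [hgΨ, ← hΦ, trans_apply_eq_add hΦs2 hT]
      have h1 := hs1 hs0.ne' x hx
      have h2 := hTr T hT x
      calc ‖Φs x + (T x - x) - Φ x‖ = ‖(Φs x - Φ x) + (T x - x)‖ := by congr 1; abel
        _ ≤ ε / 8 + ε / 8 := (norm_add_le _ _).trans (add_le_add h1 h2)
        _ = ε / 4 := by ring
    have d2 : supDist g.toHomeo.symm f.toHomeo.symm ≤ ε / 4 := by
      refine supDist_le_of_cubeExtend (by positivity) fun x hx => ?_
      have h0 : (T.trans Φs).symm x = T.symm (Φs.symm x) := rfl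
      rw [hgΨs, ← hΦs, h0]
      have h1 := hs2 hs0.ne' x hx
      rw [← rescale_symm] at h1
      have h2 := hTr T.symm hTs (Φs.symm x)
      calc ‖T.symm (Φs.symm x) - Φ.symm x‖
          = ‖(T.symm (Φs.symm x) - Φs.symm x) + (Φs.symm x - Φ.symm x)‖ := by congr 1; abel
        _ ≤ ε / 8 + ε / 8 := (norm_add_le _ _).trans (add_le_add h2 h1)
        _ = ε / 4 := by ring
    have d3 : dist g f = supDist g.toHomeo f.toHomeo +
      supDist g.toHomeo.symm f.toHomeo.symm := rfl
    rw [d3]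
    linarith
  · have hx2 : x ∉ Metric.closedBall b₂ r := fun h => disjoint_left.1 hdisj hx h
    obtain ⟨h1, h2⟩ := hid x (hb₁ x hx).2
    constructor
    · rw [trans_apply_eq_add hΦs2 hT, h1, hT x fun h => hx2 (Metric.ball_subset_closedBall h),
        sub_self, add_zero]
    · simp only [h2, fderiv_eq_id_of_notMem_closedBall hT hx2, sub_self, add_zero]

/-! ### Maps with vanishing Jacobian -/

theorem SobolevHomeo.ae_det_eq_zero {p M : ℝ} {N : (Euc n →L[ℝ] Euc n) → ℝ}
    {h : SobolevHomeo n p M N} (hJ : HasZeroJacobian h.toHomeo) {Φ : Euc n ≃ₜ Euc n}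
    {K : Euc n → (Euc n →L[ℝ] Euc n)} (hK : HasDisplacementDeriv Φ K p)
    (hΦ : ∀ x, Φ x = cubeExtend h.toHomeo x) :
    ∀ᵐ x ∂(volume.restrict (unitCube n)), (ContinuousLinearMap.id ℝ (Euc n) + K x).det = 0 := by
  obtain ⟨G, hG, hdet⟩ := hJ
  have h1 := hK.hasWeakDerivOn (unitCube n)
  rw [show (Φ : Euc n → Euc n) = cubeExtend h.toHomeo from funext hΦ] at h1
  filter_upwards [hdet, h1.ae_eq (isOpen_unitCube n) hG] with x hx1 hx2
  rw [hx2, hx1]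

/-- Around a map of maximal energy which is the identity on a ball, no map has vanishing Jacobian:
it would have definitely more energy on the ball, and hardly less energy elsewhere. -/
theorem SobolevHomeo.exists_forall_dist_lt_not_hasZeroJacobian [CompleteSpace F] (hn : 0 < n)
    (L : (Euc n →L[ℝ] Euc n) →L[ℝ] F) {p M : ℝ} (hp : 1 ≤ p)
    {N : (Euc n →L[ℝ] Euc n) → ℝ} (hN : ∀ A, N A = ‖L A‖)
    (hI : 0 < ‖L (ContinuousLinearMap.id ℝ (Euc n))‖) {c κ : ℝ} (hc : 0 < c)
    (hgap : ∀ A : Euc n →L[ℝ] Euc n, A.det = 0 →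
      ‖L (ContinuousLinearMap.id ℝ (Euc n))‖ ^ p * (1 + c) + κ * (coordTrace A - n) ≤ ‖L A‖ ^ p)
    {g : SobolevHomeo n p M N} {Ψ : Euc n ≃ₜ Euc n} {K : Euc n → (Euc n →L[ℝ] Euc n)}
    {b : Euc n} {r : ℝ} (hr : 0 < r) (hb : Metric.closedBall b r ⊆ unitCube n)
    (hK : HasDisplacementDeriv Ψ K p) (hg : ∀ x, cubeExtend g.toHomeo x = Ψ x)
    (hid : ∀ x ∈ Metric.closedBall b r, Ψ x = x ∧ K x = 0)
    (hE : ∫ x in unitCube n, ‖L (ContinuousLinearMap.id ℝ (Euc n) + K x)‖ ^ p = M) :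
    ∃ ε > 0, ∀ h : SobolevHomeo n p M N, dist h g < ε → ¬ HasZeroJacobian h.toHomeo := by
  have hp0 : 0 < p := one_pos.trans_le hp
  set β := ‖L (ContinuousLinearMap.id ℝ (Euc n))‖ ^ p with hβ
  obtain ⟨δ, hδ, ε₁, hε₁, hball⟩ := exists_energy_gap_ball L hp0 hI hc hgap b hr
  set B := Metric.ball b r with hB
  set B' := Metric.closedBall b r with hB'
  set U := unitCube n \ B' with hU
  have hBB' : B ⊆ B' := Metric.ball_subset_closedBall
  have hB'm : MeasurableSet B' := Metric.isClosed_closedBall.measurableSet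
  have hUo : IsOpen U := (isOpen_unitCube n).sdiff Metric.isClosed_closedBall
  have hUQ : U ⊆ unitCube n := sdiff_subset
  have hlp : ∀ K : Euc n → (Euc n →L[ℝ] Euc n), MemLp K (ENNReal.ofReal p) volume →
      ∀ S ⊆ unitCube n, MemLp (fun x => ContinuousLinearMap.id ℝ (Euc n) + K x) (ENNReal.ofReal p)
        (volume.restrict S) := fun K hK S hS =>
    (memLp_restrict_const_add hK _).mono_measure (Measure.restrict_mono hS le_rfl)
  have hint : ∀ K : Euc n → (Euc n →L[ℝ] Euc n), Integrable K →
      IntegrableOn (fun x => ContinuousLinearMap.id ℝ (Euc n) + K x) U := fun K hK => by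
    have h1 : IntegrableOn (fun x => ContinuousLinearMap.id ℝ (Euc n) + K x) (unitCube n) :=
      hK.const_add_integrableOn (by simp [volume_unitCube]) _
    exact h1.mono_set hUQ
  have hsplit : ∀ K : Euc n → (Euc n →L[ℝ] Euc n), MemLp K (ENNReal.ofReal p) volume →
      ∫ x in unitCube n, ‖L (ContinuousLinearMap.id ℝ (Euc n) + K x)‖ ^ p =
        (∫ x in B', ‖L (ContinuousLinearMap.id ℝ (Euc n) + K x)‖ ^ p) +
        ∫ x in U, ‖L (ContinuousLinearMap.id ℝ (Euc n) + K x)‖ ^ p := fun K hK => by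
    have h1 := integrableOn_energy L hp0 hK
    rw [← setIntegral_union disjoint_sdiff_right hUo.measurableSet (h1.mono_set hb)
      (h1.mono_set hUQ), union_sdiff_cancel hb]
  have hvol : volume.real B' = volume.real B := by
    have : Nonempty (Fin n) := ⟨⟨0, hn⟩⟩
    rw [Measure.real, Measure.real, Measure.addHaar_closedBall_eq_addHaar_ball]
  have hEB : ∫ x in B', ‖L (ContinuousLinearMap.id ℝ (Euc n) + K x)‖ ^ p =
      β * volume.real B := by
    rw [setIntegral_congr_fun (g := fun _ => β) hB'm fun x hx => by
      simp only [(hid x hx).2, add_zero, hβ], setIntegral_const, hvol, smul_eq_mul, mul_comm]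
  obtain ⟨ε₂, hε₂, hlsc⟩ := exists_lt_setIntegral_of_uniformly_close L hp hUo
    (hK.hasWeakDerivOn U) (hint K hK.integrable) (hlp K hK.memLp U hUQ)
    (c := (∫ x in U, ‖L (ContinuousLinearMap.id ℝ (Euc n) + K x)‖ ^ p) - δ / 2) (by linarith)
  refine ⟨min ε₁ ε₂, lt_min hε₁ hε₂, fun h hh hJ => ?_⟩
  obtain ⟨Φ, H, hH, hΦ, -, hHE⟩ := h.exists_displacementDeriv hp
  simp only [hN] at hHE
  have hclose : ∀ x, ‖Φ x - Ψ x‖ ≤ min ε₁ ε₂ := fun x => by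
    rw [hΦ, ← hg]
    have d : dist h g = supDist h.toHomeo g.toHomeo +
      supDist h.toHomeo.symm g.toHomeo.symm := rfl
    have := norm_cubeExtend_sub_le h.toHomeo g.toHomeo x
    have := supDist_nonneg h.toHomeo.symm g.toHomeo.symm
    linarith
  have hdet := SobolevHomeo.ae_det_eq_zero hJ hH hΦ
  have e1 := hball Φ _ (hH.hasWeakDerivOn B) (hlp H hH.memLp B (hBB'.trans hb))
    (fun x hx => by
      have := hclose x
      rw [(hid x (hBB' hx)).1] at this
      exact this.trans (min_le_left _ _))
    (ae_mono (Measure.restrict_mono (hBB'.trans hb) le_rfl) hdet)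
  have e2 := hlsc Φ _ (hH.hasWeakDerivOn U) (hint H hH.integrable) (hlp H hH.memLp U hUQ)
    fun x _ => (hclose x).trans (min_le_right _ _)
  have e3 : ∫ x in B, ‖L (ContinuousLinearMap.id ℝ (Euc n) + H x)‖ ^ p ≤
      ∫ x in B', ‖L (ContinuousLinearMap.id ℝ (Euc n) + H x)‖ ^ p :=
    setIntegral_mono_set ((integrableOn_energy L hp0 hH.memLp).mono_set hb)
      (Eventually.of_forall fun x => by change (0 : ℝ) ≤ _; positivity) hBB'.eventuallyLE
  rw [hsplit H hH.memLp] at hHE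
  rw [hsplit K hK.memLp, hEB] at hE
  linarith

/-- The maps with vanishing Jacobian form a nowhere dense set. -/
theorem isNowhereDense_hasZeroJacobian [CompleteSpace F] (hn : 2 ≤ n)
    (L : (Euc n →L[ℝ] Euc n) →L[ℝ] F) {C : ℝ} (hL : ∀ A, ‖A‖ ≤ C * ‖L A‖) {p M : ℝ} (hp : 1 ≤ p)
    {N : (Euc n →L[ℝ] Euc n) → ℝ} (hN : ∀ A, N A = ‖L A‖)
    (hgap : ∃ c > 0, ∃ κ, ∀ A : Euc n →L[ℝ] Euc n, A.det = 0 →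
      ‖L (ContinuousLinearMap.id ℝ (Euc n))‖ ^ p * (1 + c) + κ * (coordTrace A - n) ≤ ‖L A‖ ^ p) :
    IsNowhereDense {f : SobolevHomeo n p M N | HasZeroJacobian f.toHomeo} := by
  have hp0 : 0 < p := one_pos.trans_le hp
  obtain ⟨c, hc, κ, hgap⟩ := hgap
  have hI : 0 < ‖L (ContinuousLinearMap.id ℝ (Euc n))‖ := by
    have : Nonempty (Fin n) := ⟨⟨0, by omega⟩⟩
    have h1 : ‖ContinuousLinearMap.id ℝ (Euc n)‖ = 1 := ContinuousLinearMap.norm_id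
    have h2 := hL (ContinuousLinearMap.id ℝ (Euc n))
    rw [h1] at h2
    refine (norm_nonneg _).lt_of_ne fun h => ?_
    rw [← h, mul_zero] at h2
    linarith
  rcases eq_empty_or_nonempty {f : SobolevHomeo n p M N | HasZeroJacobian f.toHomeo} with h0 | h0
  · rw [h0]; exact isNowhereDense_empty
  -- the energy bound leaves room above the energy of the identity, as soon as one such map exists
  have hM : ‖L (ContinuousLinearMap.id ℝ (Euc n))‖ ^ p < M := by
    obtain ⟨f, hf⟩ := h0
    obtain ⟨Φ, K, hK, hΦ, -, hE⟩ := f.exists_displacementDeriv hp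
    simp only [hN] at hE
    exact (energy_id_lt_of_det_eq_zero L hp0 hI hc hgap hK.hasWeakDeriv hK.integrable hK.memLp
      (fun x hx => by rw [hK.eq_off x hx, sub_self]) hK.deriv_eq_zero
      (SobolevHomeo.ae_det_eq_zero hf hK hΦ)).trans_le hE
  rw [IsNowhereDense, eq_empty_iff_forall_notMem]
  intro f hf
  obtain ⟨ε, hε, hball⟩ := Metric.isOpen_iff.1 isOpen_interior f hf
  obtain ⟨g, Ψ, K, b, r, hgf, hr, hb, hK, hg, hid, hE⟩ :=
    SobolevHomeo.exists_dist_lt_energy_eq hn L hL hp hN hM f hε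
  obtain ⟨ε', hε', hno⟩ := SobolevHomeo.exists_forall_dist_lt_not_hasZeroJacobian (by omega) L hp hN
    hI hc hgap hr hb hK hg hid hE
  obtain ⟨h, hh, hhg⟩ := Metric.mem_closure_iff.1 (interior_subset (hball hgf)) ε' hε'
  rw [dist_comm] at hhg
  exact hno h hhg hh

end Maximal

theorem theorem5p1 (n : ℕ) (p M : ℝ) (hp : 1 < p) (hpn : p < n) (hM : 1 < M) :
    IsMeagre {f : SobolevHomeo n p M (operatorNorm n) | HasZeroJacobian f.toHomeo} ∧
    IsMeagre {f : SobolevHomeo n p M (frobeniusNorm n) | HasZeroJacobian f.toHomeo} := by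
  have hn : 2 ≤ n := by
    have : (1 : ℝ) < n := hp.trans hpn
    exact_mod_cast this
  constructor
  · exact (isNowhereDense_hasZeroJacobian hn (ContinuousLinearMap.id ℝ (Euc n →L[ℝ] Euc n)) (C := 1)
      (fun A => by rw [one_mul]; rfl) hp.le (fun A => rfl)
      (exists_energy_gap_operator (by omega) hp)).isMeagre
  · exact (isNowhereDense_hasZeroJacobian hn (entries n) (C := 1)
      (fun A => by rw [one_mul, norm_entries]; exact norm_le_frobeniusNorm A) hp.le
      (fun A => (norm_entries A).symm) (exists_energy_gap_frobenius (by omega) hp)).isMeagre
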